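/- Let $F$ be an algebraically closed field of characteristic zero, and let $F\langle X\rangle$ be the free associative algebra without unit over $F$ on a countable set of variables $x_1,x_2,\dots$. For an associative, not necessarily unital, $F$-algebra $A$ let $\mathrm{Id}(A)\subseteq F\langle X\rangle$ be the ideal of polynomial identities of $A$. A $T$-ideal is a two-sided ideal of $F\langle X\rangle$ that is invariant under all endomorphisms of $F\langle X\rangle$; $\langle f\rangle_T$ denotes the $T$-ideal generated by $f$. The product $IJ$ of two ideals is the linear span of all $fg$ with $f\in I$, $g\in J$. We write $[a,b]=ab-ba$ and $[a,b,c]=[[a,b],c]$. Let $G=G^{(0)}\oplus G^{(1)}$ be the infinite dimensional Grassmann algebra with $1$ on countably many generators, with its parity grading. Let $UT(d_1,\dots,d_m)_{(h_1,\dots,h_n)}$, $n=d_1+\dots+d_m$, be the algebra of upper block triangular matrices over $F$ with diagonal blocks of sizes $d_1,\dots,d_m$, with the $\mathbb Z_2$-grading in which the matrix unit $e_{ij}$ has degree $-h_i+h_j$. For a superalgebra $B=B^{(0)}\oplus B^{(1)}$ let $G(B)=(G^{(0)}\otimes B^{(0)})\oplus(G^{(1)}\otimes B^{(1)})$ be its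 Grassmann envelope; if $B$ consists of $n\times n$ matrices over $F$, the elements of $G(B)$ are written as $n\times n$ matrices over $G$. Put $$\mathcal A_6=\{(a_{ij})\in G(UT(2,3)_{(0,0,0,1,0)})\mid a_{11}=a_{21}=a_{53}=a_{54}=a_{55}=0,\ a_{33}=a_{44},\ a_{34}=a_{43}\},$$ $$\mathcal A_7=\{(a_{ij})\in G(UT(3,2)_{(0,0,1,0,0)})\mid a_{11}=a_{21}=a_{31}=a_{54}=a_{55}=0,\ a_{22}=a_{33},\ a_{23}=a_{32}\}.$$ Let $B_1,B_2$ be the algebras of upper left and lower right diagonal blocks of the elements of $\mathcal A_6$, that is, $$B_1=\{(a_{ij})\in G(UT(2)_{(0,0)})\mid a_{11}=a_{21}=0\},$$ $$B_2=\{(a_{ij})\in G(UT(3)_{(0,1,0)})\mid a_{31}=a_{32}=a_{33}=0,\ a_{11}=a_{22},\ a_{12}=a_{21}\},$$ and let $C_1,C_2$ be those of $\mathcal A_7$, that is, $$C_1=\{(a_{ij})\in G(UT(3)_{(0,0,1)})\mid a_{11}=a_{21}=a_{31}=0,\ a_{22}=a_{33},\ a_{23}=a_{32}\},$$ $$C_2=\{(a_{ij})\in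 G(UT(2)_{(0,0)})\mid a_{21}=a_{22}=0\}.$$ Then 1) $\mathrm{Id}(\mathcal A_6)=\langle x_1[x_2,x_3][x_4,x_5,x_6]x_7\rangle_T$, and $\mathrm{Id}(\mathcal A_6)=\mathrm{Id}(B_1)\,\mathrm{Id}(B_2)$; 2) $\mathrm{Id}(\mathcal A_7)=\langle x_1[x_2,x_3,x_4][x_5,x_6]x_7\rangle_T$, and $\mathrm{Id}(\mathcal A_7)=\mathrm{Id}(C_1)\,\mathrm{Id}(C_2)$. -/

import Mathlib

open scoped TensorProduct

noncomputable section

namespace SuperPI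

/-! ### Free algebra without unit, polynomial identities, `T`-ideals -/

/-- The free associative algebra `F⟨X⟩` (without unit) on a countable set of variables:
the `F`-vector space with basis the nonempty words. -/
abbrev FreeAlg (F : Type*) [Field F] : Type _ := MonoidAlgebra F (FreeSemigroup ℕ)

/-- The variable `x_i`. -/
def x (F : Type*) [Field F] (i : ℕ) : FreeAlg F :=
  MonoidAlgebra.single (FreeSemigroup.of i) 1

section Identities

variable (F : Type*) [Field F]

/-- Evaluation of polynomials at `a = (a_0, a_1, …)`: the algebra homomorphism `F⟨X⟩ → A`
with `x_i ↦ a_i`. -/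
def evalAt {A : Type*} [NonUnitalRing A] [Module F A] [IsScalarTower F A A]
    [SMulCommClass F A A] (a : ℕ → A) : FreeAlg F →ₙₐ[F] A :=
  MonoidAlgebra.liftMagma F (FreeSemigroup.lift a)

theorem evalAt_x {A : Type*} [NonUnitalRing A] [Module F A] [IsScalarTower F A A]
    [SMulCommClass F A A] (a : ℕ → A) (i : ℕ) : evalAt F a (x F i) = a i := by
  simp [evalAt, x]

/-- `Id(A)`, the set of polynomial identities of the (not necessarily unital) `F`-algebra `A`. -/
def identities (A : Type*) [NonUnitalRing A] [Module F A] [IsScalarTower F A A]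
    [SMulCommClass F A A] : Submodule F (FreeAlg F) where
  carrier := {f | ∀ a : ℕ → A, evalAt F a f = 0}
  zero_mem' a := map_zero _
  add_mem' hf hg a := by rw [map_add, hf a, hg a, add_zero]
  smul_mem' c f hf a := by rw [map_smul, hf a, smul_zero]

variable {F}

/-- A `T`-ideal of `F⟨X⟩`: a two-sided ideal (in particular a subspace) that is
invariant under all endomorphisms of `F⟨X⟩`. -/
structure IsTIdeal (I : Submodule F (FreeAlg F)) : Prop where
  mul_left : ∀ (g : FreeAlg F), ∀ f ∈ I, g * f ∈ I
  mul_right : ∀ (g : FreeAlg F), ∀ f ∈ I, f * g ∈ I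
  map_endo : ∀ (φ : FreeAlg F →ₙₐ[F] FreeAlg F), ∀ f ∈ I, φ f ∈ I

/-- `⟨S⟩_T`, the smallest `T`-ideal that contains `S`. -/
def tIdeal (S : Set (FreeAlg F)) : Submodule F (FreeAlg F) :=
  sInf {I | IsTIdeal I ∧ S ⊆ I}

/-- The product `I J` of two ideals: the span of all products `f g`, `f ∈ I`, `g ∈ J`. -/
def idealProd (I J : Submodule F (FreeAlg F)) : Submodule F (FreeAlg F) :=
  Submodule.span F {h | ∃ f ∈ I, ∃ g ∈ J, h = f * g}

end Identities

/-! ### The Grassmann algebra and Grassmann envelopes -/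

/-- The infinite dimensional Grassmann algebra `G` (with `1`), generated by countably many
anticommuting elements. -/
abbrev Grassmann (F : Type*) [Field F] : Type _ := ExteriorAlgebra F (ℕ →₀ F)

/-- `G^{(0)}` and `G^{(1)}`: the span of the monomials of even, respectively odd, length. -/
abbrev Grassmann.part (F : Type*) [Field F] (s : ZMod 2) : Submodule F (Grassmann F) :=
  CliffordAlgebra.evenOdd (0 : QuadraticForm F (ℕ →₀ F)) s

/-- The Grassmann envelope `G(B) = (G^{(0)} ⊗ B^{(0)}) ⊕ (G^{(1)} ⊗ B^{(1)})` inside `G ⊗ B`. -/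
def envelope (F : Type*) [Field F] {B : Type*} [Ring B] [Algebra F B]
    (𝓑 : ZMod 2 → Submodule F B) : Submodule F (Grassmann F ⊗[F] B) :=
  ⨆ s : ZMod 2,
    LinearMap.range (TensorProduct.map (Grassmann.part F s).subtype (𝓑 s).subtype)

/-- The homogeneous component of degree `s` of the algebra of upper block triangular `n × n`
matrices with the elementary `ℤ/2`-grading given by `h`, so that `e_{ij}` has degree
`-h_i + h_j`. The blocks are given by the function `b` that sends an index to the number
of the block to which it belongs. -/
def blockUT (F : Type*) [Field F] {n : ℕ} (b : Fin n → ℕ) (h : Fin n → ZMod 2) (s : ZMod 2) :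
    Submodule F (Matrix (Fin n) (Fin n) F) where
  carrier := {m | m.BlockTriangular b ∧ ∀ i j, m i j ≠ 0 → -h i + h j = s}
  zero_mem' := ⟨fun _ _ _ => rfl, fun i j hij => absurd rfl hij⟩
  add_mem' := by
    rintro m m' ⟨h1, h2⟩ ⟨h1', h2'⟩
    refine ⟨h1.add h1', fun i j hij => ?_⟩
    by_cases h0 : m i j = 0
    · exact h2' i j fun h0' => hij (by simp [h0, h0'])
    · exact h2 i j h0
  smul_mem' := by
    rintro c m ⟨h1, h2⟩
    refine ⟨fun i j hij => by simp [h1 hij], fun i j hij => h2 i j fun h0 => hij (by simp [h0])⟩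

/-- The Grassmann envelope of the superalgebra `blockUT F b h`, as a set of
matrices over `G` by means of the canonical isomorphism `M_n(G) ≅ G ⊗ M_n(F)`. -/
def GUT (F : Type*) [Field F] {n : ℕ} (b : Fin n → ℕ) (h : Fin n → ZMod 2) :
    Submodule F (Matrix (Fin n) (Fin n) (Grassmann F)) :=
  (envelope F (blockUT F b h)).comap
    (matrixEquivTensor (Fin n) F (Grassmann F)).toLinearEquiv.toLinearMap

/-- The Grassmann envelope of upper block triangular matrices, entry by entry. -/
theorem mem_GUT {F : Type*} [Field F] {n : ℕ} {b : Fin n → ℕ} {h : Fin n → ZMod 2}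
    {a : Matrix (Fin n) (Fin n) (Grassmann F)} :
    a ∈ GUT F b h ↔
      a.BlockTriangular b ∧ ∀ i j, a i j ∈ Grassmann.part F (-h i + h j) := by
  constructor
  · let P : Submodule F (Matrix (Fin n) (Fin n) (Grassmann F)) :=
      { carrier := {a | a.BlockTriangular b ∧ ∀ i j, a i j ∈ Grassmann.part F (-h i + h j)}
        zero_mem' := ⟨fun _ _ _ => rfl, fun i j => Submodule.zero_mem _⟩
        add_mem' := fun h1 h2 => ⟨h1.1.add h2.1, fun i j => add_mem (h1.2 i j) (h2.2 i j)⟩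
        smul_mem' := fun c m hm => ⟨fun i j hij => by simp [hm.1 hij],
          fun i j => Submodule.smul_mem _ c (hm.2 i j)⟩ }
    have key : envelope F (blockUT F b h) ≤
        P.comap (matrixEquivTensor (Fin n) F (Grassmann F)).symm.toLinearEquiv.toLinearMap := by
      refine iSup_le fun s => ?_
      rintro _ ⟨t, rfl⟩
      induction t with
      | zero => simp
      | add t t' h1 h2 => rw [map_add]; exact add_mem h1 h2
      | tmul g m =>
        obtain ⟨g, hg⟩ := g
        obtain ⟨m, hm1, hm2⟩ := m
        change (matrixEquivTensor (Fin n) F (Grassmann F)).symm (g ⊗ₜ m) ∈ P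
        rw [matrixEquivTensor_apply_symm]
        refine ⟨fun i j hij => by simp [hm1 hij], fun i j => ?_⟩
        by_cases h0 : m i j = 0
        · simp [h0]
        · rw [hm2 i j h0]
          simpa [Algebra.algebraMap_eq_smul_one] using Submodule.smul_mem _ (m i j) hg
    intro ha
    have := key ha
    change (matrixEquivTensor (Fin n) F (Grassmann F)).symm
      (matrixEquivTensor (Fin n) F (Grassmann F) a) ∈ P at this
    rwa [AlgEquiv.symm_apply_apply] at this
  · rintro ⟨h1, h2⟩
    change matrixEquivTensor (Fin n) F (Grassmann F) a ∈ envelope F (blockUT F b h)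
    rw [matrixEquivTensor_apply]
    refine Submodule.sum_mem _ fun p _ => ?_
    by_cases hb : b p.2 < b p.1
    · rw [h1 hb, TensorProduct.zero_tmul]; exact Submodule.zero_mem _
    · refine Submodule.mem_iSup_of_mem (-h p.1 + h p.2) ?_
      refine ⟨⟨a p.1 p.2, h2 _ _⟩ ⊗ₜ ⟨Matrix.single p.1 p.2 1, ?_, ?_⟩, rfl⟩
      · intro i j hij
        rw [Matrix.single_apply_of_ne]
        rintro ⟨rfl, rfl⟩
        exact hb hij
      · intro i j hij
        by_contra hne
        refine hij (Matrix.single_apply_of_ne _ _ _ _ _ ?_)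
        rintro ⟨rfl, rfl⟩
        exact hne rfl

/-- Grassmann envelopes are closed under multiplication. -/
theorem mul_mem_GUT {F : Type*} [Field F] {n : ℕ} {b : Fin n → ℕ} {h : Fin n → ZMod 2}
    {a a' : Matrix (Fin n) (Fin n) (Grassmann F)} (ha : a ∈ GUT F b h) (ha' : a' ∈ GUT F b h) :
    a * a' ∈ GUT F b h := by
  rw [mem_GUT] at *
  refine ⟨ha.1.mul ha'.1, fun i j => ?_⟩
  rw [Matrix.mul_apply]
  refine Submodule.sum_mem _ fun k _ => ?_
  have := CliffordAlgebra.evenOdd_mul_le _ _ _ (Submodule.mul_mem_mul (ha.2 i k) (ha'.2 k j))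
  rwa [show -h i + h k + (-h k + h j) = -h i + h j by ring] at this

/-! ### The algebras (row and column indices start at `0`) -/

/-- `𝒜₆ = {a ∈ G(UT(2,3)_{(0,0,0,1,0)}) | a₁₁ = a₂₁ = a₅₃ = a₅₄ = a₅₅ = 0, a₃₃ = a₄₄, a₃₄ = a₄₃}`. -/
def A6 (F : Type*) [Field F] :
    NonUnitalSubalgebra F (Matrix (Fin 5) (Fin 5) (Grassmann F)) where
  carrier := {a | a ∈ GUT F ![0, 0, 1, 1, 1] ![0, 0, 0, 1, 0] ∧
    (a 0 0 = 0 ∧ a 1 0 = 0 ∧ a 4 2 = 0 ∧ a 4 3 = 0 ∧ a 4 4 = 0) ∧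
    a 2 2 = a 3 3 ∧ a 2 3 = a 3 2}
  zero_mem' := ⟨Submodule.zero_mem _, by simp⟩
  add_mem' := by
    rintro a a' ⟨h, h'⟩ ⟨k, k'⟩
    exact ⟨add_mem h k, by simp [h', k']⟩
  smul_mem' := by
    rintro c a ⟨h, h'⟩
    exact ⟨Submodule.smul_mem _ c h, by simp [h']⟩
  mul_mem' := by
    rintro a a' ⟨h, ⟨h1, h2, h3, h4, h5⟩, h6, h7⟩ ⟨k, ⟨k1, k2, k3, k4, k5⟩, k6, k7⟩
    refine ⟨mul_mem_GUT h k, ?_⟩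
    have z (i j : Fin 5) (hij : (![0, 0, 1, 1, 1] : Fin 5 → ℕ) j < ![0, 0, 1, 1, 1] i) :
      a i j = 0 ∧ a' i j = 0 := ⟨(mem_GUT.1 h).1 hij, (mem_GUT.1 k).1 hij⟩
    have z20 := z 2 0 (by decide)
    have z21 := z 2 1 (by decide)
    have z30 := z 3 0 (by decide)
    have z31 := z 3 1 (by decide)
    have z40 := z 4 0 (by decide)
    have z41 := z 4 1 (by decide)
    simp only [Matrix.mul_apply, Fin.sum_univ_five, z20, z21, z30, z31, z40, z41,
      h1, h2, h3, h4, h5, h6, h7, k1, k2, k3, k4, k5, k6, k7]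
    simp [add_comm]

/-- The upper left block of `𝒜₆`: the matrices `(0 G⁽⁰⁾; 0 G⁽⁰⁾)`, that is,
`{a ∈ G(UT(2)_{(0,0)}) | a₁₁ = a₂₁ = 0}`. -/
def A6UpperBlock (F : Type*) [Field F] :
    NonUnitalSubalgebra F (Matrix (Fin 2) (Fin 2) (Grassmann F)) where
  carrier := {a | a ∈ GUT F ![0, 0] ![0, 0] ∧ a 0 0 = 0 ∧ a 1 0 = 0}
  zero_mem' := ⟨Submodule.zero_mem _, by simp⟩
  add_mem' := by
    rintro a a' ⟨h, h'⟩ ⟨k, k'⟩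
    exact ⟨add_mem h k, by simp [h', k']⟩
  smul_mem' := by
    rintro c a ⟨h, h'⟩
    exact ⟨Submodule.smul_mem _ c h, by simp [h']⟩
  mul_mem' := by
    rintro a a' ⟨h, h1, h2⟩ ⟨k, k1, k2⟩
    exact ⟨mul_mem_GUT h k, by simp [Matrix.mul_apply, k1, k2]⟩

/-- The lower right block of `𝒜₆`:
`{a ∈ G(UT(3)_{(0,1,0)}) | a₃₁ = a₃₂ = a₃₃ = 0, a₁₁ = a₂₂, a₁₂ = a₂₁}`. -/
def A6LowerBlock (F : Type*) [Field F] :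
    NonUnitalSubalgebra F (Matrix (Fin 3) (Fin 3) (Grassmann F)) where
  carrier := {a | a ∈ GUT F ![0, 0, 0] ![0, 1, 0] ∧
    (a 2 0 = 0 ∧ a 2 1 = 0 ∧ a 2 2 = 0) ∧ a 0 0 = a 1 1 ∧ a 0 1 = a 1 0}
  zero_mem' := ⟨Submodule.zero_mem _, by simp⟩
  add_mem' := by
    rintro a a' ⟨h, h'⟩ ⟨k, k'⟩
    exact ⟨add_mem h k, by simp [h', k']⟩
  smul_mem' := by
    rintro c a ⟨h, h'⟩
    exact ⟨Submodule.smul_mem _ c h, by simp [h']⟩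
  mul_mem' := by
    rintro a a' ⟨h, ⟨h1, h2, h3⟩, h4, h5⟩ ⟨k, ⟨k1, k2, k3⟩, k4, k5⟩
    refine ⟨mul_mem_GUT h k, ?_⟩
    simp [Matrix.mul_apply, Fin.sum_univ_three, h1, h2, h3, h4, h5, k1, k2, k3, k4, k5, add_comm]

/-- `𝒜₇ = {a ∈ G(UT(3,2)_{(0,0,1,0,0)}) | a₁₁ = a₂₁ = a₃₁ = a₅₄ = a₅₅ = 0, a₂₂ = a₃₃, a₂₃ = a₃₂}`. -/
def A7 (F : Type*) [Field F] :
    NonUnitalSubalgebra F (Matrix (Fin 5) (Fin 5) (Grassmann F)) where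
  carrier := {a | a ∈ GUT F ![0, 0, 0, 1, 1] ![0, 0, 1, 0, 0] ∧
    (a 0 0 = 0 ∧ a 1 0 = 0 ∧ a 2 0 = 0 ∧ a 4 3 = 0 ∧ a 4 4 = 0) ∧
    a 1 1 = a 2 2 ∧ a 1 2 = a 2 1}
  zero_mem' := ⟨Submodule.zero_mem _, by simp⟩
  add_mem' := by
    rintro a a' ⟨h, h'⟩ ⟨k, k'⟩
    exact ⟨add_mem h k, by simp [h', k']⟩
  smul_mem' := by
    rintro c a ⟨h, h'⟩
    exact ⟨Submodule.smul_mem _ c h, by simp [h']⟩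
  mul_mem' := by
    rintro a a' ⟨h, ⟨h1, h2, h3, h4, h5⟩, h6, h7⟩ ⟨k, ⟨k1, k2, k3, k4, k5⟩, k6, k7⟩
    refine ⟨mul_mem_GUT h k, ?_⟩
    have z (i j : Fin 5) (hij : (![0, 0, 0, 1, 1] : Fin 5 → ℕ) j < ![0, 0, 0, 1, 1] i) :
      a i j = 0 ∧ a' i j = 0 := ⟨(mem_GUT.1 h).1 hij, (mem_GUT.1 k).1 hij⟩
    have z30 := z 3 0 (by decide)
    have z31 := z 3 1 (by decide)
    have z32 := z 3 2 (by decide)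
    have z40 := z 4 0 (by decide)
    have z41 := z 4 1 (by decide)
    have z42 := z 4 2 (by decide)
    simp only [Matrix.mul_apply, Fin.sum_univ_five, z30, z31, z32, z40, z41, z42,
      h1, h2, h3, h4, h5, h6, h7, k1, k2, k3, k4, k5, k6, k7]
    simp [add_comm]

/-- The upper left block of `𝒜₇`:
`{a ∈ G(UT(3)_{(0,0,1)}) | a₁₁ = a₂₁ = a₃₁ = 0, a₂₂ = a₃₃, a₂₃ = a₃₂}`. -/
def A7UpperBlock (F : Type*) [Field F] :
    NonUnitalSubalgebra F (Matrix (Fin 3) (Fin 3) (Grassmann F)) where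
  carrier := {a | a ∈ GUT F ![0, 0, 0] ![0, 0, 1] ∧
    (a 0 0 = 0 ∧ a 1 0 = 0 ∧ a 2 0 = 0) ∧ a 1 1 = a 2 2 ∧ a 1 2 = a 2 1}
  zero_mem' := ⟨Submodule.zero_mem _, by simp⟩
  add_mem' := by
    rintro a a' ⟨h, h'⟩ ⟨k, k'⟩
    exact ⟨add_mem h k, by simp [h', k']⟩
  smul_mem' := by
    rintro c a ⟨h, h'⟩
    exact ⟨Submodule.smul_mem _ c h, by simp [h']⟩
  mul_mem' := by
    rintro a a' ⟨h, ⟨h1, h2, h3⟩, h4, h5⟩ ⟨k, ⟨k1, k2, k3⟩, k4, k5⟩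
    refine ⟨mul_mem_GUT h k, ?_⟩
    simp [Matrix.mul_apply, Fin.sum_univ_three, h1, h2, h3, h4, h5, k1, k2, k3, k4, k5, add_comm]

/-- The lower right block of `𝒜₇`: the matrices `(G⁽⁰⁾ G⁽⁰⁾; 0 0)`, that is,
`{a ∈ G(UT(2)_{(0,0)}) | a₂₁ = a₂₂ = 0}`. -/
def A7LowerBlock (F : Type*) [Field F] :
    NonUnitalSubalgebra F (Matrix (Fin 2) (Fin 2) (Grassmann F)) where
  carrier := {a | a ∈ GUT F ![0, 0] ![0, 0] ∧ a 1 0 = 0 ∧ a 1 1 = 0}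
  zero_mem' := ⟨Submodule.zero_mem _, by simp⟩
  add_mem' := by
    rintro a a' ⟨h, h'⟩ ⟨k, k'⟩
    exact ⟨add_mem h k, by simp [h', k']⟩
  smul_mem' := by
    rintro c a ⟨h, h'⟩
    exact ⟨Submodule.smul_mem _ c h, by simp [h']⟩
  mul_mem' := by
    rintro a a' ⟨h, h1, h2⟩ ⟨k, k1, k2⟩
    exact ⟨mul_mem_GUT h k, by simp [Matrix.mul_apply, h1, h2]⟩

end SuperPI

end

open SuperPI

/-! A product of a value with zero upper diagonal block and a value with zero lower diagonal block
vanishes, so $\mathrm{Id}(B_1)\mathrm{Id}(B_2)\subseteq\mathrm{Id}(\mathcal A_6)$. Since $x[y,z]$ is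
an identity of $B_1$ and $[x,y,z]t$ one of $B_2$, the $T$-ideal also lies in $\mathrm{Id}(\mathcal
A_6)$.

For both reverse inclusions it suffices to write every identity $f$ of $\mathcal A_6$ as a sum of
products $x_j\,p\,q\,x_l$, with $p$ in the ideal generated by commutators and $q$ in the ideal
generated by triple commutators of the unital free algebra (`mem_of_mem_identities_A6`). Write
$f=\sum x_jg_j$. Matrices whose $(1,2)$ entry is nonzero only for the variable $x_j$ show that the
second row of $g_j$ vanishes. By `exists_swapDiff_decomposition`, $g_j=\sum c_\mu m_\mu+\sum
s_{\mu,i}d_{\mu,i}$, where the $s_{\mu,i}$ are combinations of commutators and that second row is a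
polynomial in the entries $a_{22}$ whose coefficients involve $c_\mu$ and the values of $d_{\mu,i}$
on $B_2$. Over an infinite field these coefficients vanish separately, so $c_\mu=0$ and certain rows
of $d_{\mu,i}$ vanish on $B_2$.

The corner $\begin{pmatrix}p&q\\q&p\end{pmatrix}$ of $B_2$, with $p$ even and $q$ odd, is a copy of
$G$, and the last column detects the last letter. Hence $d_{\mu,i}=\sum k_lx_l$, where $k_l$
vanishes in the $(1,1)$ entry on enough of this copy. Modulo triple commutators $k_l$ is a
combination of commutative monomials times multilinear products of commutators
(`exists_sub_mem_lieIdeal`). Evaluation at scalars plus Grassmann generators shows that this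
combination is zero (`smul_cprod_eq_zero`), so $k_l$ lies in the ideal of triple commutators.

The algebra $\mathcal A_7$ is anti-isomorphic to $\mathcal A_6$, and likewise for the blocks, so the
second half follows by reversing words. -/

noncomputable section

namespace SuperPI

/-! ### The free algebra with unit -/

section Unital

variable (F : Type*) [Field F]

/-- The free associative algebra with unit, obtained from `F⟨X⟩` by adjoining a unit. -/
def UFree : Type _ := Unitization F (FreeAlg F)

instance : Ring (UFree F) := inferInstanceAs (Ring (Unitization F (FreeAlg F)))

instance : Algebra F (UFree F) := inferInstanceAs (Algebra F (Unitization F (FreeAlg F)))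

variable {F}

/-- The inclusion of `F⟨X⟩` in the free algebra with unit. -/
def UFree.incl : FreeAlg F →ₙₐ[F] UFree F where
  toFun r := (Unitization.inr r : Unitization F (FreeAlg F))
  map_smul' c r := Unitization.inr_smul F c r
  map_zero' := Unitization.inr_zero F
  map_add' := Unitization.inr_add F
  map_mul' := Unitization.inr_mul F

open SuperPI.UFree (incl)

theorem UFree.incl_injective : Function.Injective (incl (F := F)) := Unitization.inr_injective

theorem UFree.exists_eq (f : UFree F) : ∃ (c : F) (r : FreeAlg F), f = algebraMap F _ c + incl r := by
  refine Unitization.ind (P := fun f : Unitization F (FreeAlg F) =>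
    ∃ (c : F) (r : FreeAlg F), f = (algebraMap F (UFree F) c + incl r : UFree F)) ?_ f
  exact fun c r => ⟨c, r, rfl⟩

variable (F) in
/-- The variables of the unital free algebra. -/
def X (i : ℕ) : UFree F := incl (x F i)

/-- Evaluation of unital polynomials in a unital algebra. -/
def evalU {A : Type*} [Ring A] [Algebra F A] (a : ℕ → A) : UFree F →ₐ[F] A :=
  (Unitization.lift (evalAt F a) : Unitization F (FreeAlg F) →ₐ[F] A)

@[simp] theorem evalU_incl {A : Type*} [Ring A] [Algebra F A] (a : ℕ → A) (f : FreeAlg F) :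
    evalU a (incl f) = evalAt F a f := by
  change (Unitization.lift (evalAt F a) : Unitization F (FreeAlg F) →ₐ[F] A) (Unitization.inr f) = _
  simp

@[simp] theorem evalU_X {A : Type*} [Ring A] [Algebra F A] (a : ℕ → A) (i : ℕ) :
    evalU a (X F i) = a i := by
  rw [X, evalU_incl, evalAt_x]

theorem FreeAlg.mem_of_single {V : Submodule F (FreeAlg F)}
    (h : ∀ w, (MonoidAlgebra.single w 1 : FreeAlg F) ∈ V) (f : FreeAlg F) : f ∈ V := by
  induction f using MonoidAlgebra.induction_linear with
  | zero => exact V.zero_mem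
  | add f g hf hg => exact V.add_mem hf hg
  | single w c =>
    have := V.smul_mem c (h w)
    rwa [MonoidAlgebra.smul_single, smul_eq_mul, mul_one] at this

/-- Nonunital algebra homomorphisms on `F⟨X⟩` are determined by the images of the variables. -/
theorem FreeAlg.hom_ext {A : Type*} [NonUnitalRing A] [Module F A] [IsScalarTower F A A]
    [SMulCommClass F A A] {φ ψ : FreeAlg F →ₙₐ[F] A} (h : ∀ i, φ (x F i) = ψ (x F i)) : φ = ψ := by
  refine NonUnitalAlgHom.ext fun f => ?_
  refine FreeAlg.mem_of_single
    (V := LinearMap.eqLocus (φ : FreeAlg F →ₗ[F] A) (ψ : FreeAlg F →ₗ[F] A)) (fun w => ?_) _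
  change φ _ = ψ _
  induction w using FreeSemigroup.recOnMul with
  | ih1 i => exact h i
  | ih2 i w h1 h2 =>
    have : (MonoidAlgebra.single (FreeSemigroup.of i * w) 1 : FreeAlg F) =
      MonoidAlgebra.single (FreeSemigroup.of i) 1 * MonoidAlgebra.single w 1 := by
        rw [MonoidAlgebra.single_mul_single, one_mul]
    rw [this, map_mul, map_mul, h1, h2]

/-- The polynomials $r$ with $Vr\subseteq V$ are closed under products and linear combinations, so
stability under the variables gives stability under everything. This reduces claims about
polynomials to appending one letter. -/
theorem UFree.mem_of_mul_X_mem {V : Submodule F (UFree F)} (h1 : 1 ∈ V)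
    (hX : ∀ v ∈ V, ∀ k, v * X F k ∈ V) (f : UFree F) : f ∈ V := by
  have key (r : FreeAlg F) : ∀ v ∈ V, v * incl r ∈ V := by
    intro v
    refine fun hv => FreeAlg.mem_of_single (V := { carrier := {r | ∀ v ∈ V, v * incl r ∈ V}
                                                   zero_mem' := fun v _ => by simp
                                                   add_mem' := fun ha hb v hv => by
                                                    rw [map_add, mul_add]
                                                    exact V.add_mem (ha v hv) (hb v hv)
                                                   smul_mem' := fun c a ha v hv => by
                                                    rw [map_smul, mul_smul_comm]
                                                    exact V.smul_mem _ (ha v hv) })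
      (fun w => ?_) r v hv
    change ∀ v ∈ V, _
    induction w using FreeSemigroup.recOnMul with
    | ih1 i => exact fun v hv => hX v hv i
    | ih2 i w h1 h2 =>
      intro v hv
      have : (MonoidAlgebra.single (FreeSemigroup.of i * w) 1 : FreeAlg F) =
        MonoidAlgebra.single (FreeSemigroup.of i) 1 * MonoidAlgebra.single w 1 := by
          rw [MonoidAlgebra.single_mul_single, one_mul]
      rw [this, map_mul, ← mul_assoc]
      exact h2 _ (h1 v hv)
  obtain ⟨c, r, rfl⟩ := f.exists_eq
  refine V.add_mem ?_ (by simpa using key r 1 h1)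
  rw [Algebra.algebraMap_eq_smul_one]
  exact V.smul_mem c h1

end Unital

/-! ### Words and products of commutators -/

section Words

variable {Q : Type*} [Ring Q] (y : ℕ → Q)

/-- The value of the word `l` at `y`. -/
def word (l : List ℕ) : Q := (l.map y).prod

@[simp] theorem word_nil : word y [] = 1 := rfl

@[simp] theorem word_cons (a : ℕ) (l : List ℕ) : word y (a :: l) = y a * word y l := by
  simp [word]

@[simp] theorem word_append (l l' : List ℕ) : word y (l ++ l') = word y l * word y l' := by
  simp [word]

/-- The product of the commutators of the consecutive pairs of entries of a list
(zero if the length is odd). -/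
def cprod : List ℕ → Q
  | [] => 1
  | [_] => 0
  | a :: b :: l => ⁅y a, y b⁆ * cprod l

@[simp] theorem cprod_nil : cprod y [] = 1 := rfl

@[simp] theorem cprod_singleton (a : ℕ) : cprod y [a] = 0 := rfl

@[simp] theorem cprod_cons_cons (a b : ℕ) (l : List ℕ) :
    cprod y (a :: b :: l) = ⁅y a, y b⁆ * cprod y l := rfl

theorem map_word {F Q' : Type*} [Field F] [Ring Q'] [Algebra F Q] [Algebra F Q'] (φ : Q →ₐ[F] Q')
    (l : List ℕ) : φ (word y l) = word (fun i => φ (y i)) l := by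
  induction l with
  | nil => simp
  | cons a l ih => simp [ih]

theorem map_cprod {F Q' : Type*} [Field F] [Ring Q'] [Algebra F Q] [Algebra F Q'] (φ : Q →ₐ[F] Q') :
    ∀ l : List ℕ, φ (cprod y l) = cprod (fun i => φ (y i)) l
  | [] => by simp
  | [_] => by simp
  | a :: b :: l => by simp [map_cprod φ l, Ring.lie_def]

theorem cprod_of_odd_length : ∀ l : List ℕ, ¬ Even l.length → cprod y l = 0
  | [] => by simp
  | [_] => by simp
  | a :: b :: l => fun h => by
    rw [cprod_cons_cons, cprod_of_odd_length l, mul_zero]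
    simpa [Nat.even_add_one] using h

variable {y} (hQ : ∀ a b c : Q, ⁅⁅a, b⁆, c⁆ = 0)

include hQ

theorem lie_mul_comm_of_lie_lie (a b c : Q) : ⁅a, b⁆ * c = c * ⁅a, b⁆ := by
  have := hQ a b c
  rwa [Ring.lie_def, sub_eq_zero] at this

/-- Expand $[[ad,b],c]=0$ by the Leibniz rule: the terms with triple commutators drop out, leaving
$[a,b][d,c]+[a,c][d,b]=0$. Thus a product of commutators is alternating across factors too, and is
determined up to sign by its set of letters. -/
theorem lie_mul_lie_swap (a b c d : Q) : ⁅a, b⁆ * ⁅c, d⁆ = -(⁅a, c⁆ * ⁅b, d⁆) := by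
  have h1 : ⁅⁅a * d, b⁆, c⁆ = ⁅a, b⁆ * ⁅d, c⁆ + ⁅a, c⁆ * ⁅d, b⁆ +
      (a * ⁅⁅d, b⁆, c⁆ + ⁅⁅a, b⁆, c⁆ * d) := by
    simp only [Ring.lie_def]; noncomm_ring
  rw [hQ, hQ, hQ, mul_zero, zero_mul, add_zero, add_zero] at h1
  have h2 : ⁅d, c⁆ = -⁅c, d⁆ := by simp only [Ring.lie_def]; abel
  have h3 : ⁅d, b⁆ = -⁅b, d⁆ := by simp only [Ring.lie_def]; abel
  rw [h2, h3, mul_neg, mul_neg, ← neg_add, zero_eq_neg] at h1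
  exact eq_neg_of_add_eq_zero_left h1

theorem cprod_mul_comm (c : Q) : ∀ l : List ℕ, cprod y l * c = c * cprod y l
  | [] => by simp
  | [_] => by simp
  | a :: b :: l => by
    rw [cprod_cons_cons, mul_assoc, cprod_mul_comm c l, ← mul_assoc,
      lie_mul_comm_of_lie_lie hQ, mul_assoc]

theorem cprod_append_swap (a b : ℕ) (l : List ℕ) :
    ∀ p : List ℕ, cprod y (p ++ b :: a :: l) = -cprod y (p ++ a :: b :: l)
  -- Peeling off pairs leaves a swap inside one commutator, or across two adjacent ones. In the
  -- second case with nothing following, both lists have odd length and both products are zero.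
  | [] => by
    simp only [List.nil_append, cprod_cons_cons]
    rw [← neg_mul]
    simp only [Ring.lie_def, neg_sub]
  | [c] => by
    cases l with
    | nil => simp
    | cons d l =>
      simp only [List.cons_append, List.nil_append, cprod_cons_cons]
      rw [← mul_assoc, lie_mul_lie_swap hQ, ← mul_assoc, neg_mul]
  | c :: d :: p => by
    simp only [List.cons_append, cprod_cons_cons]
    rw [cprod_append_swap a b l p, mul_neg]

theorem cprod_perm {l l' : List ℕ} (h : l.Perm l') (p : List ℕ) :
    cprod y (p ++ l') = cprod y (p ++ l) ∨ cprod y (p ++ l') = -cprod y (p ++ l) := by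
  induction h generalizing p with
  | nil => exact Or.inl rfl
  | cons a _ ih => simpa using ih (p ++ [a])
  | swap a b l => exact Or.inr (cprod_append_swap hQ b a l p)
  | trans _ _ h1 h2 =>
    rcases h1 p with h1 | h1 <;> rcases h2 p with h2 | h2 <;> simp [h1, h2]

/-- Two equal letters can be moved to the front at the cost of a sign, where they form
$[y_a,y_a]=0$; no division by 2 is needed. -/
theorem cprod_eq_zero_of_not_nodup {l : List ℕ} (h : ¬ l.Nodup) : cprod y l = 0 := by
  obtain ⟨a, ha⟩ : ∃ a, a ∈ l ∧ a ∈ l.erase a := by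
    by_contra! hc
    refine h (List.nodup_iff_count_le_one.2 fun a => ?_)
    by_cases hal : a ∈ l
    · have := List.count_eq_zero.2 (hc a hal)
      rw [List.count_erase_self] at this
      omega
    · rw [List.count_eq_zero.2 hal]; exact zero_le_one
  have h1 : (a :: a :: (l.erase a).erase a).Perm l :=
    ((List.perm_cons_erase ha.2).symm.cons a).trans (List.perm_cons_erase ha.1).symm
  rcases cprod_perm hQ h1 [] with h2 | h2 <;> simpa [Ring.lie_def] using h2

variable {F : Type*} [Field F] [Algebra F Q]

/-- Letters of the word are sorted into the order chosen by `Multiset.toList`. Each transposition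
costs a central commutator, which joins the product of commutators and leaves a word shorter by two
letters, whence the induction on length. -/
theorem word_mul_cprod_mem (l L : List ℕ) :
    word y l * cprod y L ∈ Submodule.span F
      (Set.range fun p : Multiset ℕ × Finset ℕ => word y p.1.toList * cprod y p.2.toList) := by
  set W := Submodule.span F
      (Set.range fun p : Multiset ℕ × Finset ℕ => word y p.1.toList * cprod y p.2.toList) with hW
  obtain ⟨n, hn⟩ : ∃ n, l.length < n := ⟨_, Nat.lt_succ_self _⟩
  induction n generalizing l L with
  | zero => simp at hn
  | succ n ih =>
    have perm {l l' : List ℕ} (h : l.Perm l') : ∀ p : List ℕ, (p ++ l).length < n + 1 →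
        word y (p ++ l) * cprod y L - word y (p ++ l') * cprod y L ∈ W := by
      induction h with
      | nil => simp
      | cons a _ ih => exact fun p hp => by simpa [mul_assoc] using ih (p ++ [a]) (by simpa using hp)
      | swap a b l =>
        intro p hp
        have := ih (p ++ l) (b :: a :: L) (by simp at hp ⊢; omega)
        convert this using 1
        have hc := lie_mul_comm_of_lie_lie hQ (y b) (y a) (word y l)
        simp only [word_append, word_cons, cprod_cons_cons, mul_assoc]
        rw [← mul_assoc (word y l), ← hc, Ring.lie_def]
        noncomm_ring
      | trans h _ h1 h2 =>
        intro p hp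
        have := add_mem (h1 p hp) (h2 p (by simpa [h.length_eq] using hp))
        simpa using this
    have h1 : word y l * cprod y L - word y (l : Multiset ℕ).toList * cprod y L ∈ W :=
      perm (Multiset.coe_eq_coe.1 (Multiset.coe_toList (l : Multiset ℕ)).symm) [] (by simpa using hn)
    have h2 : word y (l : Multiset ℕ).toList * cprod y L ∈ W := by
      by_cases hL : L.Nodup
      · have h3 : word y (l : Multiset ℕ).toList * cprod y L.toFinset.toList ∈ W :=
          Submodule.subset_span ⟨((l : Multiset ℕ), L.toFinset), rfl⟩
        have h4 : L.toFinset.toList.Perm L := List.toFinset_toList hL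
        rcases cprod_perm hQ h4 [] with h5 | h5 <;> simp only [List.nil_append] at h5 <;> rw [h5]
        · exact h3
        · rw [mul_neg]; exact neg_mem h3
      · rw [cprod_eq_zero_of_not_nodup hQ hL, mul_zero]; exact zero_mem _
    simpa using add_mem h1 h2

end Words

/-! ### The ideals of commutators -/

section Ideals

variable {F : Type*} [Field F]

variable (F) in
/-- The ideal of the unital free algebra generated by all commutators. -/
def commIdeal : TwoSidedIdeal (UFree F) :=
  TwoSidedIdeal.span {h | ∃ a b : UFree F, h = ⁅a, b⁆}

variable (F) in
/-- The ideal of the unital free algebra generated by all commutators of length three. -/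
def lieIdeal : TwoSidedIdeal (UFree F) :=
  TwoSidedIdeal.span {h | ∃ a b c : UFree F, h = ⁅⁅a, b⁆, c⁆}

theorem word_sub_word_mem_commIdeal {l l' : List ℕ} (h : l.Perm l') :
    word (X F) l - word (X F) l' ∈ commIdeal F := by
  induction h with
  | nil => simp [zero_mem]
  | cons a _ ih =>
    rw [word_cons, word_cons, ← mul_sub]
    exact TwoSidedIdeal.mul_mem_left _ _ _ ih
  | swap a b l =>
    have : word (X F) (b :: a :: l) - word (X F) (a :: b :: l) = ⁅X F b, X F a⁆ * word (X F) l := by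
      simp only [word_cons, Ring.lie_def]; noncomm_ring
    rw [this]
    exact TwoSidedIdeal.mul_mem_right _ _ _ (TwoSidedIdeal.subset_span ⟨_, _, rfl⟩)
  | trans _ _ h1 h2 => simpa using add_mem h1 h2

/-- Modulo the ideal generated by the commutators of length three, the unital free algebra
is spanned by products of a commutative monomial and a multilinear product of commutators. -/
theorem exists_sub_mem_lieIdeal (f : UFree F) :
    ∃ c : Multiset ℕ × Finset ℕ →₀ F,
      f - c.sum (fun p r => r • (word (X F) p.1.toList * cprod (X F) p.2.toList)) ∈ lieIdeal F := by
  let π : UFree F →ₐ[F] (lieIdeal F).ringCon.Quotient := { (lieIdeal F).ringCon.mk' with commutes' := fun _ => rfl }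
  have hπ (a : UFree F) : π a = 0 ↔ a ∈ lieIdeal F := by
    have := TwoSidedIdeal.mem_ker (lieIdeal F).ringCon.mk' (x := a)
    rw [TwoSidedIdeal.ker_ringCon_mk'] at this
    exact this.symm
  have hsurj : Function.Surjective π := (lieIdeal F).ringCon.mk'_surjective
  have hQ (a b c : (lieIdeal F).ringCon.Quotient) : ⁅⁅a, b⁆, c⁆ = 0 := by
    obtain ⟨a, rfl⟩ := hsurj a
    obtain ⟨b, rfl⟩ := hsurj b
    obtain ⟨c, rfl⟩ := hsurj c
    have : π ⁅⁅a, b⁆, c⁆ = 0 := (hπ _).2 (TwoSidedIdeal.subset_span ⟨_, _, _, rfl⟩)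
    simpa [Ring.lie_def] using this
  set y : ℕ → (lieIdeal F).ringCon.Quotient := fun i => π (X F i)
  have key : π f ∈ Submodule.span F
      (Set.range fun p : Multiset ℕ × Finset ℕ => word y p.1.toList * cprod y p.2.toList) := by
    refine UFree.mem_of_mul_X_mem (V := (Submodule.span F
      (Set.range fun p : Multiset ℕ × Finset ℕ =>
        word y p.1.toList * cprod y p.2.toList)).comap π.toLinearMap) ?_ ?_ f
    · simpa using word_mul_cprod_mem (y := y) (F := F) hQ [] []
    · intro v hv k
      rw [Submodule.mem_comap, AlgHom.toLinearMap_apply, map_mul]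
      rw [Submodule.mem_comap, AlgHom.toLinearMap_apply] at hv
      generalize π v = z at hv
      induction hv using Submodule.span_induction with
      | mem a ha =>
        obtain ⟨p, rfl⟩ := ha
        -- The product of commutators is central, so the new letter slides past it to the end of the
        -- word.
        have := word_mul_cprod_mem (y := y) (F := F) hQ (p.1.toList ++ [k]) p.2.toList
        simpa [mul_assoc, cprod_mul_comm hQ] using this
      | zero => rw [zero_mul]; exact zero_mem _
      | add a b _ _ ha hb => rw [add_mul]; exact add_mem ha hb
      | smul c a _ ha => rw [smul_mul_assoc]; exact Submodule.smul_mem _ _ ha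
  obtain ⟨c, hc⟩ := Finsupp.mem_span_range_iff_exists_finsupp.1 key
  refine ⟨c, (hπ _).1 ?_⟩
  rw [map_sub, ← hc, map_finsuppSum, sub_eq_zero]
  refine Finsupp.sum_congr fun p _ => ?_
  rw [map_smul, map_mul, map_word, map_cprod]

end Ideals

/-! ### `T`-ideals and ideals of the unital free algebra. -/

section TIdeals

variable {F : Type*} [Field F]

open SuperPI.UFree (incl)

theorem isTIdeal_identities (A : Type*) [NonUnitalRing A] [Module F A] [IsScalarTower F A A]
    [SMulCommClass F A A] : IsTIdeal (identities F A) where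
  mul_left g f hf a := by rw [map_mul, hf a, mul_zero]
  mul_right g f hf a := by rw [map_mul, hf a, zero_mul]
  map_endo φ f hf a := by
    have : (evalAt F a).comp φ = evalAt F fun i => evalAt F a (φ (x F i)) :=
      FreeAlg.hom_ext fun i => by simp [evalAt_x]
    change (evalAt F a).comp φ f = 0
    rw [this]
    exact hf _

theorem isTIdeal_tIdeal (S : Set (FreeAlg F)) : IsTIdeal (tIdeal S) where
  mul_left g f hf := by
    rw [tIdeal, Submodule.mem_sInf] at *
    exact fun I hI => hI.1.mul_left g f (hf I hI)
  mul_right g f hf := by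
    rw [tIdeal, Submodule.mem_sInf] at *
    exact fun I hI => hI.1.mul_right g f (hf I hI)
  map_endo φ f hf := by
    rw [tIdeal, Submodule.mem_sInf] at *
    exact fun I hI => hI.1.map_endo φ f (hf I hI)

theorem subset_tIdeal (S : Set (FreeAlg F)) : S ⊆ tIdeal S := fun f hf => by
  rw [SetLike.mem_coe, tIdeal, Submodule.mem_sInf]
  exact fun I hI => hI.2 hf

theorem tIdeal_le {S : Set (FreeAlg F)} {I : Submodule F (FreeAlg F)} (hI : IsTIdeal I)
    (hS : S ⊆ I) : tIdeal S ≤ I := sInf_le ⟨hI, hS⟩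

theorem exists_incl_eq_incl_mul (r : FreeAlg F) (a : UFree F) :
    ∃ s, incl s = incl r * a := by
  obtain ⟨c, a, rfl⟩ := a.exists_eq
  refine ⟨c • r + r * a, ?_⟩
  rw [map_add, map_smul, map_mul, mul_add, ← Algebra.commutes, Algebra.smul_def]

theorem exists_incl_eq_mul_incl (r : FreeAlg F) (a : UFree F) :
    ∃ s, incl s = a * incl r := by
  obtain ⟨c, a, rfl⟩ := a.exists_eq
  refine ⟨c • r + a * r, ?_⟩
  rw [map_add, map_smul, map_mul, add_mul, Algebra.smul_def]

/-- Commutators in the unital free algebra are commutators in `F⟨X⟩`. -/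
theorem exists_lie_eq_incl_lie (a b : UFree F) : ∃ r s : FreeAlg F, ⁅a, b⁆ = incl ⁅r, s⁆ := by
  obtain ⟨c, r, rfl⟩ := a.exists_eq
  obtain ⟨d, s, rfl⟩ := b.exists_eq
  refine ⟨r, s, ?_⟩
  have h1 := Algebra.commutes c (incl s)
  have h2 := Algebra.commutes d (incl r)
  have h3 := Algebra.commutes c (algebraMap F (UFree F) d)
  simp only [Ring.lie_def, map_sub, map_mul, mul_add, add_mul, h1, h2, h3]
  abel

theorem exists_lie_lie_eq_incl_lie_lie (a b c : UFree F) :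
    ∃ r s t : FreeAlg F, ⁅⁅a, b⁆, c⁆ = incl ⁅⁅r, s⁆, t⁆ := by
  obtain ⟨r, s, h⟩ := exists_lie_eq_incl_lie a b
  obtain ⟨d, t, rfl⟩ := c.exists_eq
  refine ⟨r, s, t, ?_⟩
  have h1 := Algebra.commutes d (incl ⁅r, s⁆)
  rw [h]
  simp only [Ring.lie_def ⁅r, s⁆, Ring.lie_def (incl ⁅r, s⁆), map_sub, map_mul, mul_add, add_mul, h1]
  abel

section

variable {I : Submodule F (FreeAlg F)} (hI : IsTIdeal I)

include hI

theorem IsTIdeal.incl_mul_mem {z : UFree F} (hz : z ∈ I.map (incl (F := F) : FreeAlg F →ₗ[F] UFree F))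
    (a : UFree F) : z * a ∈ I.map (incl (F := F) : FreeAlg F →ₗ[F] UFree F) := by
  obtain ⟨r, hr, rfl⟩ := hz
  obtain ⟨c, a, rfl⟩ := a.exists_eq
  refine ⟨c • r + r * a, add_mem (Submodule.smul_mem _ _ hr) (hI.mul_right _ _ hr), ?_⟩
  change incl _ = incl r * _
  rw [map_add, map_smul, map_mul, mul_add, ← Algebra.commutes, Algebra.smul_def]

theorem IsTIdeal.mul_incl_mem {z : UFree F} (hz : z ∈ I.map (incl (F := F) : FreeAlg F →ₗ[F] UFree F))
    (a : UFree F) : a * z ∈ I.map (incl (F := F) : FreeAlg F →ₗ[F] UFree F) := by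
  obtain ⟨r, hr, rfl⟩ := hz
  obtain ⟨c, a, rfl⟩ := a.exists_eq
  refine ⟨c • r + a * r, add_mem (Submodule.smul_mem _ _ hr) (hI.mul_left _ _ hr), ?_⟩
  change incl _ = _ * incl r
  rw [map_add, map_smul, map_mul, add_mul, Algebra.smul_def]

/-- If a `T`-ideal contains `x₀[x₁,x₂]`, then it contains all `r p` with `p` in the ideal
generated by commutators. -/
theorem IsTIdeal.incl_mul_commIdeal_mem
    (h : ∀ y a b : FreeAlg F, y * ⁅a, b⁆ ∈ I) (r : FreeAlg F) {p : UFree F} (hp : p ∈ commIdeal F) :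
    incl r * p ∈ I.map (incl (F := F) : FreeAlg F →ₗ[F] UFree F) := by
  -- The admissible $p$ form a two-sided ideal, because a left factor is absorbed by the arbitrary
  -- $r$; hence only commutators need checking.
  let J : TwoSidedIdeal (UFree F) := TwoSidedIdeal.mk'
    {p | ∀ r, incl r * p ∈ I.map (incl (F := F) : FreeAlg F →ₗ[F] UFree F)}
    (fun r => by rw [mul_zero]; exact zero_mem _)
    (fun ha hb r => by rw [mul_add]; exact add_mem (ha r) (hb r))
    (fun ha r => by rw [mul_neg]; exact neg_mem (ha r))
    (fun {a p} hp r => by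
      obtain ⟨s, hs⟩ := exists_incl_eq_incl_mul r a
      rw [← mul_assoc, ← hs]; exact hp s)
    (fun {p a} hp r => by
      rw [← mul_assoc]
      exact hI.incl_mul_mem (hp r) a)
  have hJ : commIdeal F ≤ J := by
    rw [commIdeal, TwoSidedIdeal.span_le]
    rintro _ ⟨a, b, rfl⟩
    rw [SetLike.mem_coe, TwoSidedIdeal.mem_mk']
    intro r
    obtain ⟨s, t, hst⟩ := exists_lie_eq_incl_lie a b
    rw [hst, ← map_mul]
    exact ⟨_, h _ _ _, rfl⟩
  exact (TwoSidedIdeal.mem_mk' _ _ _ _ _ _ _).1 (hJ hp) r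

/-- If a `T`-ideal contains `[x₀,x₁,x₂]x₃`, then it contains all `q r` with `q` in the ideal
generated by commutators of length three. -/
theorem IsTIdeal.lieIdeal_mul_incl_mem
    (h : ∀ a b c y : FreeAlg F, ⁅⁅a, b⁆, c⁆ * y ∈ I) {q : UFree F} (hq : q ∈ lieIdeal F)
    (r : FreeAlg F) : q * incl r ∈ I.map (incl (F := F) : FreeAlg F →ₗ[F] UFree F) := by
  let J : TwoSidedIdeal (UFree F) := TwoSidedIdeal.mk'
    {q | ∀ r, q * incl r ∈ I.map (incl (F := F) : FreeAlg F →ₗ[F] UFree F)}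
    (fun r => by rw [zero_mul]; exact zero_mem _)
    (fun ha hb r => by rw [add_mul]; exact add_mem (ha r) (hb r))
    (fun ha r => by rw [neg_mul]; exact neg_mem (ha r))
    (fun {a p} hp r => by
      rw [mul_assoc]
      exact hI.mul_incl_mem (hp r) a)
    (fun {p a} hp r => by
      obtain ⟨s, hs⟩ := exists_incl_eq_mul_incl r a
      rw [mul_assoc, ← hs]; exact hp s)
  have hJ : lieIdeal F ≤ J := by
    rw [lieIdeal, TwoSidedIdeal.span_le]
    rintro _ ⟨a, b, c, rfl⟩
    rw [SetLike.mem_coe, TwoSidedIdeal.mem_mk']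
    intro r
    obtain ⟨s, t, u, hst⟩ := exists_lie_lie_eq_incl_lie_lie a b c
    rw [hst, ← map_mul]
    exact ⟨_, h _ _ _ _, rfl⟩
  exact (TwoSidedIdeal.mem_mk' _ _ _ _ _ _ _).1 (hJ hq) r

end

/-- If a subspace contains all values of `x₁[x₂,x₃][x₄,x₅,x₆]x₇`, then it contains all products
`r p q s`, with `p` in the ideal generated by commutators and `q` in the ideal generated by
commutators of length three. -/
theorem incl_mul_commIdeal_mul_lieIdeal_mem {I : Submodule F (FreeAlg F)}
    (h : ∀ y a b c d e z : FreeAlg F, y * ⁅a, b⁆ * ⁅⁅c, d⁆, e⁆ * z ∈ I)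
    {p q : UFree F} (hp : p ∈ commIdeal F) (hq : q ∈ lieIdeal F) (r s : FreeAlg F) :
    incl r * p * (q * incl s) ∈ I.map (incl (F := F) : FreeAlg F →ₗ[F] UFree F) := by
  let J : TwoSidedIdeal (UFree F) := TwoSidedIdeal.mk'
    {q | ∀ (r s : FreeAlg F) (a b : UFree F),
      incl r * ⁅a, b⁆ * (q * incl s) ∈ I.map (incl (F := F) : FreeAlg F →ₗ[F] UFree F)}
    (fun r s a b => by rw [zero_mul, mul_zero]; exact zero_mem _)
    (fun ha hb r s a b => by rw [add_mul, mul_add]; exact add_mem (ha r s a b) (hb r s a b))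
    (fun ha r s a b => by rw [neg_mul, mul_neg]; exact neg_mem (ha r s a b))
    (fun {a p} hp r s b c => by
      obtain ⟨t, ht⟩ := exists_incl_eq_incl_mul r c
      -- A factor between the commutator and $p$ is removed by $[b,c]a=[b,ca]-c[b,a]$, with $c$ then
      -- absorbed by $r$.
      have h1 : incl r * ⁅b, c⁆ * (a * p * incl s) =
          incl r * ⁅b, c * a⁆ * (p * incl s) - incl t * ⁅b, a⁆ * (p * incl s) := by
        rw [ht]; simp only [Ring.lie_def]; noncomm_ring
      rw [h1]
      exact sub_mem (hp _ _ _ _) (hp _ _ _ _))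
    (fun {p a} hp r s b c => by
      obtain ⟨t, ht⟩ := exists_incl_eq_mul_incl s a
      rw [mul_assoc p, ← ht]; exact hp _ _ _ _)
  have hJ : lieIdeal F ≤ J := by
    rw [lieIdeal, TwoSidedIdeal.span_le]
    rintro _ ⟨a, b, c, rfl⟩
    rw [SetLike.mem_coe, TwoSidedIdeal.mem_mk']
    intro r s d e
    obtain ⟨t, u, v, hst⟩ := exists_lie_lie_eq_incl_lie_lie a b c
    obtain ⟨k, l, hkl⟩ := exists_lie_eq_incl_lie d e
    rw [hst, hkl, ← map_mul, ← map_mul, ← map_mul, ← mul_assoc]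
    exact ⟨_, h _ _ _ _ _ _ _, rfl⟩
  let K : TwoSidedIdeal (UFree F) := TwoSidedIdeal.mk'
    {p | ∀ q ∈ lieIdeal F, ∀ r s,
      incl r * p * (q * incl s) ∈ I.map (incl (F := F) : FreeAlg F →ₗ[F] UFree F)}
    (fun q _ r s => by rw [mul_zero, zero_mul]; exact zero_mem _)
    (fun ha hb q hq r s => by rw [mul_add, add_mul]; exact add_mem (ha q hq r s) (hb q hq r s))
    (fun ha q hq r s => by rw [mul_neg, neg_mul]; exact neg_mem (ha q hq r s))
    (fun {a p} hp q hq r s => by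
      obtain ⟨t, ht⟩ := exists_incl_eq_incl_mul r a
      rw [← mul_assoc (incl r), ← ht]; exact hp q hq t s)
    (fun {p a} hp q hq r s => by
      have := hp (a * q) (TwoSidedIdeal.mul_mem_left _ _ _ hq) r s
      simpa only [mul_assoc] using this)
  have hK : commIdeal F ≤ K := by
    rw [commIdeal, TwoSidedIdeal.span_le]
    rintro _ ⟨a, b, rfl⟩
    rw [SetLike.mem_coe, TwoSidedIdeal.mem_mk']
    intro q hq r s
    exact (TwoSidedIdeal.mem_mk' _ _ _ _ _ _ _).1 (hJ hq) r s a b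
  exact (TwoSidedIdeal.mem_mk' _ _ _ _ _ _ _).1 (hK hp) q hq r s

/-! ### Decompositions of polynomials -/

theorem exists_eq_sum_mul_X (f : UFree F) :
    ∃ (c : F) (g : ℕ →₀ UFree F), f = algebraMap F _ c + g.sum fun l h => h * X F l := by
  have h0 (l : ℕ) : (0 : UFree F) * X F l = 0 := zero_mul _
  let V : Submodule F (UFree F) :=
    { carrier := {f | ∃ (c : F) (g : ℕ →₀ UFree F), f = algebraMap F _ c + g.sum fun l h => h * X F l}
      zero_mem' := ⟨0, 0, by simp⟩
      add_mem' := by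
        rintro _ _ ⟨c, g, rfl⟩ ⟨d, k, rfl⟩
        refine ⟨c + d, g + k, ?_⟩
        rw [Finsupp.sum_add_index' h0 fun _ _ _ => add_mul _ _ _, map_add]
        abel
      smul_mem' := by
        rintro r _ ⟨c, g, rfl⟩
        refine ⟨r • c, g.mapRange (r • ·) (smul_zero _), ?_⟩
        rw [Finsupp.sum_mapRange_index h0, smul_add, Finsupp.smul_sum, Algebra.algebraMap_eq_smul_one,
          Algebra.algebraMap_eq_smul_one, smul_assoc]
        simp only [smul_mul_assoc] }
  refine UFree.mem_of_mul_X_mem (V := V) ⟨1, 0, by simp⟩ ?_ f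
  rintro v - k
  exact ⟨0, Finsupp.single k v, by simp⟩

theorem FreeAlg.exists_eq_sum_X_mul (f : FreeAlg F) :
    ∃ g : ℕ →₀ UFree F, incl f = g.sum fun j h => X F j * h := by
  have h0 (l : ℕ) : X F l * (0 : UFree F) = 0 := mul_zero _
  let V : Submodule F (FreeAlg F) :=
    { carrier := {f | ∃ g : ℕ →₀ UFree F, incl f = g.sum fun j h => X F j * h}
      zero_mem' := ⟨0, by simp⟩
      add_mem' := by
        rintro _ _ ⟨g, hg⟩ ⟨k, hk⟩
        refine ⟨g + k, ?_⟩
        rw [Finsupp.sum_add_index' h0 fun _ _ _ => mul_add _ _ _, map_add, hg, hk]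
      smul_mem' := by
        rintro r _ ⟨g, hg⟩
        refine ⟨g.mapRange (r • ·) (smul_zero _), ?_⟩
        rw [Finsupp.sum_mapRange_index h0, map_smul, hg, Finsupp.smul_sum]
        simp only [mul_smul_comm] }
  refine FreeAlg.mem_of_single (V := V) (fun w => ?_) f
  induction w using FreeSemigroup.recOnMul with
  | ih1 i => exact ⟨Finsupp.single i 1, by simp [X, x]⟩
  | ih2 i w h1 h2 =>
    refine ⟨Finsupp.single i (incl (MonoidAlgebra.single w 1)), ?_⟩
    rw [Finsupp.sum_single_index (h := fun j h => X F j * h) (h0 i), X, ← map_mul, x,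
      MonoidAlgebra.single_mul_single, one_mul]

/-- The word corresponding to a commutative monomial. -/
def monoWord (F : Type*) [Field F] (m : Multiset ℕ) : UFree F := word (X F) m.toList

/-- The difference of the two ways to multiply a commutative monomial by a variable. -/
def swapDiff (F : Type*) [Field F] (p : Multiset ℕ × ℕ) : UFree F :=
  monoWord F p.1 * X F p.2 - monoWord F (p.2 ::ₘ p.1)

theorem swapDiff_mem_commIdeal (p : Multiset ℕ × ℕ) : swapDiff F p ∈ commIdeal F := by
  have : swapDiff F p = word (X F) (p.1.toList ++ [p.2]) - word (X F) (p.2 ::ₘ p.1).toList := by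
    simp [swapDiff, monoWord]
  rw [this]
  refine word_sub_word_mem_commIdeal (Multiset.coe_eq_coe.1 ?_)
  rw [Multiset.coe_toList, ← Multiset.coe_add, Multiset.coe_toList, add_comm]
  rfl

/-- Telescoping decomposition of a polynomial: a combination of commutative monomials, plus a
sum of multiples of the `swapDiff`, whose coefficients are the noncommutative derivatives that
govern the evaluation in block triangular matrices. -/
theorem exists_swapDiff_decomposition {S : Type*} [Ring S] [Algebra F S] {m n : Type*} [Fintype m]
    [Fintype n] [DecidableEq m] [DecidableEq n] (φ : (n → S) →ₗ[F] (m → S)) (f : UFree F) :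
    ∃ (c : Multiset ℕ →₀ F) (d : Multiset ℕ × ℕ →₀ UFree F),
      f = c.sum (fun μ r => r • monoWord F μ) + d.sum (fun p h => swapDiff F p * h) ∧
      ∀ (a : ℕ → Matrix m m S) (L : ℕ → Matrix n n S) (ρ : m → S) (b : ℕ → F) (v : ℕ → n → S),
        (∀ k, Matrix.vecMul ρ (a k) = b k • ρ + φ (v k)) →
        (∀ k u, Matrix.vecMul (φ u) (a k) = φ (Matrix.vecMul u (L k))) →
        Matrix.vecMul ρ (evalU a f) =
          c.sum (fun μ r => (μ.map b).prod • r • ρ) +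
          d.sum (fun p h => (p.1.map b).prod • φ (Matrix.vecMul (v p.2) (evalU L h))) := by
  let V : Submodule F (UFree F) :=
    { carrier := {f | ∃ (c : Multiset ℕ →₀ F) (d : Multiset ℕ × ℕ →₀ UFree F),
        f = c.sum (fun μ r => r • monoWord F μ) + d.sum (fun p h => swapDiff F p * h) ∧
        ∀ (a : ℕ → Matrix m m S) (L : ℕ → Matrix n n S) (ρ : m → S) (b : ℕ → F) (v : ℕ → n → S),
        (∀ k, Matrix.vecMul ρ (a k) = b k • ρ + φ (v k)) →
        (∀ k u, Matrix.vecMul (φ u) (a k) = φ (Matrix.vecMul u (L k))) →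
        Matrix.vecMul ρ (evalU a f) =
          c.sum (fun μ r => (μ.map b).prod • r • ρ) +
          d.sum (fun p h => (p.1.map b).prod • φ (Matrix.vecMul (v p.2) (evalU L h))) }
      zero_mem' := ⟨0, 0, by simp, by simp⟩
      add_mem' := by
        rintro _ _ ⟨c, d, rfl, h⟩ ⟨c', d', rfl, h'⟩
        refine ⟨c + c', d + d', ?_, ?_⟩
        · rw [Finsupp.sum_add_index' (by simp) (by simp [add_smul]),
            Finsupp.sum_add_index' (by simp) (by simp [mul_add])]
          abel
        · intro a L ρ b v h1 h2
          rw [map_add, Matrix.vecMul_add, h a L ρ b v h1 h2, h' a L ρ b v h1 h2,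
            Finsupp.sum_add_index' (by simp) (by simp [add_smul]),
            Finsupp.sum_add_index' (by simp) (by simp [Matrix.vecMul_add])]
          abel
      smul_mem' := by
        rintro r _ ⟨c, d, rfl, h⟩
        refine ⟨r • c, d.mapRange (r • ·) (smul_zero _), ?_, ?_⟩
        · rw [Finsupp.sum_smul_index' (by simp), Finsupp.sum_mapRange_index (by simp), smul_add,
            Finsupp.smul_sum, Finsupp.smul_sum]
          simp only [mul_smul_comm, smul_assoc]
        · intro a L ρ b v h1 h2
          rw [map_smul, Matrix.vecMul_smul, h a L ρ b v h1 h2, Finsupp.sum_smul_index' (by simp),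
            Finsupp.sum_mapRange_index (by simp), smul_add, Finsupp.smul_sum, Finsupp.smul_sum]
          simp only [map_smul, Matrix.vecMul_smul, smul_assoc, smul_comm r] }
  have hword (l : List ℕ) : ∃ d : Multiset ℕ × ℕ →₀ UFree F,
      word (X F) l = monoWord F l + d.sum (fun p h => swapDiff F p * h) ∧
      ∀ (a : ℕ → Matrix m m S) (L : ℕ → Matrix n n S) (ρ : m → S) (b : ℕ → F) (v : ℕ → n → S),
        (∀ k, Matrix.vecMul ρ (a k) = b k • ρ + φ (v k)) →
        (∀ k u, Matrix.vecMul (φ u) (a k) = φ (Matrix.vecMul u (L k))) →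
        Matrix.vecMul ρ (evalU a (word (X F) l)) = (((l : Multiset ℕ).map b).prod • ρ) +
          d.sum (fun p h => (p.1.map b).prod • φ (Matrix.vecMul (v p.2) (evalU L h))) := by
    induction l using List.reverseRecOn with
    | nil => exact ⟨0, by simp [monoWord], fun a L ρ b v h1 h2 => by simp⟩
    | append_singleton l k ih =>
      obtain ⟨d, hd, hd'⟩ := ih
      have hl : ((l ++ [k] : List ℕ) : Multiset ℕ) = k ::ₘ (l : Multiset ℕ) := by
        rw [← Multiset.coe_add, add_comm]; rfl
      -- Each prefix $l$ and next letter $k$ contributes an entry at $(l,k)$ whose coefficient is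
      -- the remaining suffix. It records that the row $\rho$ collects $b^l$ and then leaves its
      -- line through $v_k$. Entries with `swapDiff` equal to zero are kept: they do not affect the
      -- polynomial identity, but they do enter the evaluation formula.
      refine ⟨d.mapRange (· * X F k) (zero_mul _) + Finsupp.single ((l : Multiset ℕ), k) 1, ?_, ?_⟩
      · rw [Finsupp.sum_add_index' (by simp) (by simp [mul_add]),
          Finsupp.sum_mapRange_index (by simp), Finsupp.sum_single_index (by simp), word_append,
          word_cons, word_nil, mul_one, hd, add_mul, Finsupp.sum_mul, hl, swapDiff]
        simp only [mul_assoc, mul_one]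
        abel
      · intro a L ρ b v h1 h2
        rw [Finsupp.sum_add_index' (by simp) (by simp [Matrix.vecMul_add]),
          Finsupp.sum_mapRange_index (by simp), Finsupp.sum_single_index (by simp), word_append,
          word_cons, word_nil, mul_one, map_mul, ← Matrix.vecMul_vecMul, hd' a L ρ b v h1 h2,
          evalU_X, Matrix.add_vecMul, Matrix.smul_vecMul, h1, Finsupp.sum, Finsupp.sum,
          Matrix.sum_vecMul, hl]
        simp only [Matrix.smul_vecMul, h2, map_mul, evalU_X, Matrix.vecMul_vecMul, Multiset.map_cons,
          Multiset.prod_cons, map_one, Matrix.vecMul_one, smul_add, smul_smul, mul_comm]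
        abel
  let W : Submodule F (UFree F) := Submodule.span F (Set.range (word (X F)))
  have hW : W ≤ V := by
    refine Submodule.span_le.2 ?_
    rintro _ ⟨l, rfl⟩
    obtain ⟨d, hd, hd'⟩ := hword l
    refine ⟨Finsupp.single (l : Multiset ℕ) 1, d, by simpa using hd, fun a L ρ b v h1 h2 => ?_⟩
    rw [hd' a L ρ b v h1 h2, Finsupp.sum_single_index (by simp), one_smul]
  refine hW (UFree.mem_of_mul_X_mem (V := W) (Submodule.subset_span ⟨[], rfl⟩) ?_ f)
  intro v hv k
  induction hv using Submodule.span_induction with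
  | mem a ha =>
    obtain ⟨l, rfl⟩ := ha
    exact Submodule.subset_span ⟨l ++ [k], by simp⟩
  | zero => rw [zero_mul]; exact zero_mem _
  | add a b _ _ ha hb => rw [add_mul]; exact add_mem ha hb
  | smul c a _ ha => rw [smul_mul_assoc]; exact Submodule.smul_mem _ _ ha

end TIdeals

/-! ### Separating coefficients over an infinite field. -/

section Evaluations

variable {F : Type*} [Field F]

open SuperPI.UFree (incl)

/-- A vector valued polynomial function over an infinite field vanishes only if all its
coefficients do. -/
theorem eq_zero_of_forall_sum_prod_smul_eq_zero [Infinite F] {V : Type*} [AddCommGroup V]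
    [Module F V] (s : Finset (Multiset ℕ)) (c : Multiset ℕ → V)
    (h : ∀ b : ℕ → F, ∑ μ ∈ s, (μ.map b).prod • c μ = 0) {μ : Multiset ℕ} (hμ : μ ∈ s) :
    c μ = 0 := by
  rw [← Module.forall_dual_apply_eq_zero_iff F]
  intro φ
  -- Applying a linear functional makes the coefficients scalar; a polynomial vanishing at all
  -- points of an infinite field is zero.
  let P : MvPolynomial ℕ F := ∑ μ ∈ s, MvPolynomial.monomial (Multiset.toFinsupp μ) (φ (c μ))
  have hP : P = 0 := by
    refine MvPolynomial.funext fun b => ?_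
    have h1 := congrArg φ (h b)
    rw [map_sum, map_zero] at h1
    rw [map_zero, ← h1, map_sum]
    refine Finset.sum_congr rfl fun ν _ => ?_
    rw [MvPolynomial.eval_monomial, map_smul, smul_eq_mul, mul_comm, Finsupp.prod,
      Multiset.toFinsupp_support, Finset.prod_multiset_map_count]
    simp
  have h2 : MvPolynomial.coeff (Multiset.toFinsupp μ) P = φ (c μ) := by
    simp only [P, MvPolynomial.coeff_sum, MvPolynomial.coeff_monomial,
      EmbeddingLike.apply_eq_iff_eq]
    rw [Finset.sum_ite_eq' s μ, if_pos hμ]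
  rw [← h2, hP, MvPolynomial.coeff_zero]

/-! ### The Grassmann algebra -/

/-- The generators of the Grassmann algebra. -/
def gen (F : Type*) [Field F] (i : ℕ) : Grassmann F := ExteriorAlgebra.ι F (Finsupp.single i 1)

theorem gen_mem_part (i : ℕ) : gen F i ∈ Grassmann.part F 1 :=
  CliffordAlgebra.ι_mem_evenOdd_one _ _

theorem algebraMap_mem_part (c : F) : algebraMap F (Grassmann F) c ∈ Grassmann.part F 0 := by
  rw [Algebra.algebraMap_eq_smul_one]
  exact Submodule.smul_mem _ _ (SetLike.one_mem_graded (Grassmann.part F))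

theorem ι_mul_eq_involute_mul_ι (m : ℕ →₀ F) (a : Grassmann F) :
    ExteriorAlgebra.ι F m * a = CliffordAlgebra.involute a * ExteriorAlgebra.ι F m := by
  induction a using ExteriorAlgebra.induction with
  | algebraMap r => rw [← Algebra.commutes]; congr 1; exact (AlgHom.commutes _ r).symm
  | ι n =>
    have h1 : CliffordAlgebra.involute (ExteriorAlgebra.ι F n : Grassmann F) =
      -ExteriorAlgebra.ι F n := CliffordAlgebra.involute_ι n
    rw [h1, neg_mul, eq_neg_iff_add_eq_zero]
    exact ExteriorAlgebra.ι_add_mul_swap m n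
  | mul a b ha hb => rw [← mul_assoc, ha, mul_assoc, hb, map_mul, mul_assoc]
  | add a b ha hb => rw [mul_add, ha, hb, map_add, add_mul]

theorem ι_mul_comm_of_even (m : ℕ →₀ F) {a : Grassmann F} (ha : a ∈ Grassmann.part F 0) :
    ExteriorAlgebra.ι F m * a = a * ExteriorAlgebra.ι F m := by
  rw [ι_mul_eq_involute_mul_ι]
  congr 1
  exact CliffordAlgebra.involute_eq_of_mem_even ha

theorem mul_comm_of_even {a : Grassmann F} (ha : a ∈ Grassmann.part F 0) (b : Grassmann F) :
    a * b = b * a := by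
  induction b using ExteriorAlgebra.induction with
  | algebraMap r => exact (Algebra.commutes r a).symm
  | ι n => exact (ι_mul_comm_of_even n ha).symm
  | mul b c hb hc => rw [← mul_assoc, hb, mul_assoc, hc, mul_assoc]
  | add b c hb hc => rw [mul_add, hb, hc, add_mul]

theorem mul_eq_neg_mul_of_odd {a b : Grassmann F} (ha : a ∈ Grassmann.part F 1)
    (hb : b ∈ Grassmann.part F 1) : a * b = -(b * a) := by
  induction b, hb using CliffordAlgebra.odd_induction with
  | ι n =>
    have h1 := ι_mul_eq_involute_mul_ι n a
    have h2 : CliffordAlgebra.involute a = -a := CliffordAlgebra.involute_eq_of_mem_odd ha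
    rw [h2, neg_mul] at h1
    change a * ExteriorAlgebra.ι F n = -(ExteriorAlgebra.ι F n * a)
    rw [h1, neg_neg]
  | add b c hb hc h1 h2 => rw [mul_add, h1, h2, add_mul, neg_add]
  | ι_mul_ι_mul m n b hb h =>
    have h1 : CliffordAlgebra.ι (0 : QuadraticForm F (ℕ →₀ F)) m *
        CliffordAlgebra.ι (0 : QuadraticForm F (ℕ →₀ F)) n ∈ Grassmann.part F 0 :=
      CliffordAlgebra.ι_mul_ι_mem_evenOdd_zero _ m n
    rw [← mul_assoc a, ← mul_comm_of_even h1 a, mul_assoc, h, mul_neg, ← mul_assoc]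

/-- Contraction with the coordinate functional of the first generator strips that generator off,
since the same contraction kills a product in which the generator does not occur. -/
theorem prod_gen_ne_zero {l : List ℕ} (hl : l.Nodup) : (l.map (gen F)).prod ≠ 0 := by
  have contr (i : ℕ) (l : List ℕ) (hi : i ∉ l) :
      CliffordAlgebra.contractLeft (Q := (0 : QuadraticForm F (ℕ →₀ F))) (Finsupp.lapply (R := F) i)
        (l.map (gen F)).prod = 0 := by
    induction l with
    | nil => exact CliffordAlgebra.contractLeft_one (Q := (0 : QuadraticForm F (ℕ →₀ F))) _
    | cons a l ih =>
      rw [List.mem_cons, not_or] at hi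
      rw [List.map_cons, List.prod_cons]
      refine (CliffordAlgebra.contractLeft_ι_mul _ _ _).trans ?_
      rw [ih hi.2, mul_zero, sub_zero, Finsupp.lapply_apply, Finsupp.single_apply,
        if_neg (Ne.symm hi.1), zero_smul]
  induction l with
  | nil => simp
  | cons i l ih =>
    rw [List.nodup_cons] at hl
    intro h0
    refine ih hl.2 ?_
    have h1 := congrArg (CliffordAlgebra.contractLeft (Q := (0 : QuadraticForm F (ℕ →₀ F)))
      (Finsupp.lapply i)) h0
    rw [List.map_cons, List.prod_cons, map_zero] at h1
    have h2 := (CliffordAlgebra.contractLeft_ι_mul (Q := (0 : QuadraticForm F (ℕ →₀ F)))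
      (Finsupp.lapply (R := F) i) (Finsupp.single i 1) (l.map (gen F)).prod).symm.trans h1
    rw [contr i l hl.1, mul_zero, sub_zero, Finsupp.lapply_apply, Finsupp.single_eq_same,
      one_smul] at h2
    exact h2

theorem gen_mul_prod_gen_eq_zero {i : ℕ} {l : List ℕ} (h : i ∈ l) :
    gen F i * (l.map (gen F)).prod = 0 := by
  induction l with
  | nil => simp at h
  | cons a l ih =>
    rw [List.map_cons, List.prod_cons]
    rcases List.mem_cons.1 h with rfl | h
    · rw [← mul_assoc, gen, ExteriorAlgebra.ι_sq_zero, zero_mul]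
    · rw [← mul_assoc, mul_eq_neg_mul_of_odd (gen_mem_part i) (gen_mem_part a), neg_mul, mul_assoc,
        ih h, mul_zero, neg_zero]

/-! ### Evaluations in the lower right block -/

/-- Elements of the lower right block of `𝒜₆`. -/
def lowerElt (t r : F) (q : Grassmann F) : Matrix (Fin 3) (Fin 3) (Grassmann F) :=
  !![algebraMap F _ t, q, algebraMap F _ r; q, algebraMap F _ t, 0; 0, 0, 0]

theorem lowerElt_mem {t r : F} {q : Grassmann F} (hq : q ∈ Grassmann.part F 1) :
    lowerElt t r q ∈ A6LowerBlock F := by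
  refine ⟨mem_GUT.2 ⟨fun i j hij => ?_, fun i j => ?_⟩, ?_⟩
  · fin_cases i <;> fin_cases j <;> simp at hij
  · fin_cases i <;> fin_cases j <;>
      simp [lowerElt, algebraMap_mem_part, hq, show (-1 : ZMod 2) = 1 from rfl,
        show (1 + 1 : ZMod 2) = 0 from rfl]
  · simp [lowerElt]

/-- A column vector concentrated in the first coordinate. -/
def firstCol (z : Grassmann F) : Fin 3 → Grassmann F := ![z, 0, 0]

theorem lowerElt_mulVec_firstCol (t r : F) (q z : Grassmann F) (h : q * z = 0) :
    (lowerElt t r q).mulVec (firstCol z) = firstCol (t • z) := by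
  ext i; fin_cases i <;> simp [lowerElt, firstCol, Matrix.mulVec, dotProduct, Fin.sum_univ_three, h,
    Algebra.smul_def]

/-- The scalars $t,t'$ cancel in the commutator and $qq'-q'q=2qq'$ for odd elements. The last column
is not seen, as the vector has last coordinate zero. -/
theorem lie_lowerElt_mulVec_firstCol (t r t' r' : F) {q q' : Grassmann F}
    (hq : q ∈ Grassmann.part F 1) (hq' : q' ∈ Grassmann.part F 1) (z : Grassmann F) :
    (⁅lowerElt t r q, lowerElt t' r' q'⁆).mulVec (firstCol z) =
      firstCol ((2 : F) • (q * (q' * z))) := by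
  have h1 : q' * (q * z) = -(q * (q' * z)) := by
    rw [← mul_assoc, mul_eq_neg_mul_of_odd hq' hq, neg_mul, mul_assoc]
  have h2 : algebraMap F (Grassmann F) t * (algebraMap F (Grassmann F) t' * z) =
      algebraMap F (Grassmann F) t' * (algebraMap F (Grassmann F) t * z) := by
    rw [← mul_assoc, ← mul_assoc, Algebra.commutes]
  have h3 (t : F) (q : Grassmann F) : q * (algebraMap F (Grassmann F) t * z) =
      algebraMap F (Grassmann F) t * (q * z) := by
    rw [← mul_assoc, ← mul_assoc, Algebra.commutes]
  have h4 := h3 t q'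
  have h5 := h3 t' q
  rw [Ring.lie_def, Matrix.sub_mulVec, ← Matrix.mulVec_mulVec, ← Matrix.mulVec_mulVec]
  ext i; fin_cases i
  · simp [lowerElt, firstCol, dotProduct, Fin.sum_univ_three, h1, two_smul]
    rw [h2]
    abel
  · simp [lowerElt, firstCol, dotProduct, Fin.sum_univ_three, h4, h5]
    abel
  · simp [lowerElt, firstCol, dotProduct, Fin.sum_univ_three]

theorem word_mulVec_firstCol (t r : ℕ → F) (q : ℕ → Grassmann F) (z : Grassmann F)
    (h : ∀ i, q i * z = 0) (l : List ℕ) :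
    (word (fun i => lowerElt (t i) (r i) (q i)) l).mulVec (firstCol z) =
      firstCol ((l.map t).prod • z) := by
  induction l with
  | nil => simp
  | cons a l ih =>
    rw [word_cons, ← Matrix.mulVec_mulVec, ih, lowerElt_mulVec_firstCol, List.map_cons,
      List.prod_cons, smul_smul]
    rw [mul_smul_comm, h, smul_zero]

theorem cprod_mulVec_firstCol (t r : ℕ → F) (q : ℕ → Grassmann F)
    (hq : ∀ i, q i ∈ Grassmann.part F 1) : ∀ l : List ℕ, Even l.length →
    (cprod (fun i => lowerElt (t i) (r i) (q i)) l).mulVec (firstCol 1) =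
      firstCol ((2 : F) ^ (l.length / 2) • (l.map q).prod)
  | [] => by simp
  | [_] => by simp
  | a :: b :: l => fun h => by
    rw [cprod_cons_cons, ← Matrix.mulVec_mulVec, cprod_mulVec_firstCol t r q hq l,
      lie_lowerElt_mulVec_firstCol _ _ _ _ (hq a) (hq b)]
    · have : (a :: b :: l).length / 2 = l.length / 2 + 1 := by simp only [List.length_cons]; omega
      rw [this, List.map_cons, List.map_cons, List.prod_cons, List.prod_cons, mul_smul_comm,
        mul_smul_comm, smul_smul, pow_succ']
    · simpa [Nat.even_add_one] using h

/-- A combination of the normal forms modulo the commutators of length three that vanishes on the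
lower right block of `𝒜₆` is zero. -/
theorem smul_cprod_eq_zero [CharZero F] (γ : Multiset ℕ × Finset ℕ →₀ F) (r : ℕ → F)
    (h : ∀ (t : ℕ → F) (q : ℕ → Grassmann F), (∀ i, q i ∈ Grassmann.part F 1) →
      (evalU (fun i => lowerElt (t i) (r i) (q i)) (γ.sum fun p c =>
        c • (word (X F) p.1.toList * cprod (X F) p.2.toList))).mulVec (firstCol 1) 0 = 0)
    (J : Finset ℕ) (μ : Multiset ℕ) : γ (μ, J) • cprod (X F) J.toList = 0 := by
  induction J using Finset.strongInduction generalizing μ with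
  | H J ih =>
  -- For odd $|J|$ the product of commutators is zero by convention and says nothing about the
  -- coefficient; hence the conclusion concerns $\gamma\cdot$`cprod` and not $\gamma$.
  by_cases hJ : Even J.toList.length
  swap
  · rw [cprod_of_odd_length _ _ hJ, smul_zero]
  by_cases hμ : (μ, J) ∈ γ.support
  swap
  · rw [Finsupp.notMem_support_iff.1 hμ, zero_smul]
  -- With these odd parts the product of commutators over $J$ produces a nonzero multiple of $e$.
  -- Each $q_i$ annihilates $e$, so the word in front acts only through the scalars $t_i$.
  let q : ℕ → Grassmann F := fun i => if i ∈ J then gen F i else 0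
  have hq (i : ℕ) : q i ∈ Grassmann.part F 1 := by
    by_cases hi : i ∈ J
    · simp only [q, if_pos hi]; exact gen_mem_part i
    · simp only [q, if_neg hi]; exact zero_mem _
  set e : Grassmann F := (J.toList.map (gen F)).prod with he
  have hqe (i : ℕ) : q i * e = 0 := by
    by_cases hi : i ∈ J
    · simp only [q, if_pos hi]; exact gen_mul_prod_gen_eq_zero (Finset.mem_toList.2 hi)
    · simp only [q, if_neg hi, zero_mul]
  have hJe : (J.toList.map q).prod = e := by
    congr 1
    refine List.map_congr_left fun i hi => ?_
    simp only [q, if_pos (Finset.mem_toList.1 hi)]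
  have key (t : ℕ → F) : ∑ ν ∈ γ.support.image Prod.fst,
      (ν.map t).prod • γ (ν, J) • (2 : F) ^ (J.toList.length / 2) • e = 0 := by
    have h1 := h t q hq
    rw [map_finsuppSum, Finsupp.sum, Matrix.sum_mulVec, Finset.sum_apply] at h1
    have h2 (p : Multiset ℕ × Finset ℕ) :
        (evalU (fun i => lowerElt (t i) (r i) (q i)) (γ p • (word (X F) p.1.toList *
          cprod (X F) p.2.toList))).mulVec (firstCol 1) 0 =
        if p.2 = J then (p.1.map t).prod • γ p • (2 : F) ^ (J.toList.length / 2) • e else 0 := by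
      obtain ⟨ν, K⟩ := p
      dsimp only
      split_ifs with hK
      · subst hK
        rw [map_smul, map_mul, map_word, map_cprod, Matrix.smul_mulVec, ← Matrix.mulVec_mulVec]
        simp only [evalU_X]
        rw [cprod_mulVec_firstCol t r q hq _ hJ, hJe, word_mulVec_firstCol]
        · have : (ν.toList.map t).prod = (ν.map t).prod := by
            rw [← Multiset.prod_coe, ← Multiset.map_coe, Multiset.coe_toList]
          rw [this, Pi.smul_apply]
          change γ (ν, K) • ((ν.map t).prod • (2 : F) ^ (K.toList.length / 2) • e) = _
          rw [smul_comm (γ (ν, K)), smul_comm (γ (ν, K))]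
        · intro i
          rw [mul_smul_comm, hqe, smul_zero]
      -- Proper subsets of $J$ contribute nothing by induction; any other $K\ne J$ contains a letter
      -- whose odd part is zero.
      · by_cases hKJ : K ⊆ J
        · rw [← mul_smul_comm, ih K (lt_of_le_of_ne hKJ hK), mul_zero, map_zero, Matrix.zero_mulVec]
          rfl
        · rw [map_smul, map_mul, map_word, map_cprod, Matrix.smul_mulVec, ← Matrix.mulVec_mulVec]
          simp only [evalU_X]
          by_cases hKe : Even K.toList.length
          · rw [cprod_mulVec_firstCol t r q hq _ hKe]
            have h3 : (K.toList.map q).prod = 0 := by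
              obtain ⟨i, hi, hi'⟩ := Finset.not_subset.1 hKJ
              refine List.prod_eq_zero (List.mem_map.2 ⟨i, Finset.mem_toList.2 hi, ?_⟩)
              simp only [q, if_neg hi']
            have h4 : firstCol (0 : Grassmann F) = 0 := by
              ext i; fin_cases i <;> rfl
            rw [h3, smul_zero, h4, Matrix.mulVec_zero, smul_zero]
            rfl
          · rw [cprod_of_odd_length _ _ hKe, Matrix.zero_mulVec, Matrix.mulVec_zero, smul_zero]
            rfl
    rw [Finset.sum_congr rfl fun p _ => h2 p] at h1
    rw [← h1, ← Finset.sum_filter]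
    symm
    -- The monomials $\nu$ run over all first components of the support, so $(\nu,J)$ may lie
    -- outside it; such terms are zero.
    refine Finset.sum_bij_ne_zero (fun p _ _ => p.1) ?_ ?_ ?_ ?_
    · intro p hp _
      exact Finset.mem_image_of_mem _ (Finset.mem_filter.1 hp).1
    · intro p hp _ p' hp' _ hpp
      exact Prod.ext hpp ((Finset.mem_filter.1 hp).2.trans (Finset.mem_filter.1 hp').2.symm)
    · intro ν _ hν
      refine ⟨(ν, J), Finset.mem_filter.2 ⟨?_, rfl⟩, hν, rfl⟩
      rw [Finsupp.mem_support_iff]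
      intro h0
      rw [h0, zero_smul, smul_zero] at hν
      exact hν rfl
    · intro p hp _
      rw [← (Finset.mem_filter.1 hp).2]
  have h5 := eq_zero_of_forall_sum_prod_smul_eq_zero _ _ key (Finset.mem_image_of_mem _ hμ)
  rcases smul_eq_zero.1 h5 with h6 | h6
  · exact absurd h6 (Finsupp.mem_support_iff.1 hμ)
  · rcases smul_eq_zero.1 h6 with h7 | h7
    · exact absurd h7 (pow_ne_zero _ two_ne_zero)
    · exact absurd h7 (prod_gen_ne_zero J.nodup_toList)

end Evaluations

section Blocks

variable {F : Type*} [Field F]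

open SuperPI.UFree (incl)

theorem mem_identities_subalgebra {A : Type*} [Ring A] [Algebra F A] {S : NonUnitalSubalgebra F A}
    {f : FreeAlg F} :
    f ∈ identities F S ↔ ∀ a : ℕ → A, (∀ i, a i ∈ S) → evalAt F a f = 0 := by
  have key (a : ℕ → S) : (evalAt F a f : A) = evalAt F (fun i => (a i : A)) f := by
    have : (NonUnitalSubalgebraClass.subtype S).comp (evalAt F a) =
        evalAt F (fun i => (a i : A)) := FreeAlg.hom_ext fun i => by simp [evalAt_x]
    exact DFunLike.congr_fun this f
  refine ⟨fun h a ha => ?_, fun h a => ?_⟩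
  · have := key fun i => ⟨a i, ha i⟩
    rw [← this, h fun i => ⟨a i, ha i⟩]
    rfl
  · rw [← ZeroMemClass.coe_eq_zero, key]
    exact h _ fun i => (a i).2

/-! ### The identities of the blocks -/

/-- Even elements commute, so a commutator has only its upper right entry; a left factor with zero
first column kills it. -/
theorem mul_lie_mem_identities_upperBlock (a b c : FreeAlg F) :
    a * ⁅b, c⁆ ∈ identities F (A6UpperBlock F) := by
  intro v
  rw [Ring.lie_def, map_mul, map_sub, map_mul, map_mul]
  generalize evalAt F v a = M
  generalize evalAt F v b = N
  generalize evalAt F v c = P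
  obtain ⟨M, -, hM0, hM1⟩ := M
  obtain ⟨N, hN, hN0, hN1⟩ := N
  obtain ⟨P, hP, hP0, hP1⟩ := P
  have h1 : N 1 1 * P 1 1 = P 1 1 * N 1 1 := by
    have := (mem_GUT.1 hN).2 1 1
    exact mul_comm_of_even (by simpa using this) _
  apply Subtype.ext
  change M * (N * P - P * N) = 0
  ext i j
  fin_cases i <;> fin_cases j <;>
    simp [Matrix.mul_apply, Fin.sum_univ_two, hM0, hM1, hN0, hN1, hP0, hP1, h1]

theorem exists_eq_of_mem_lowerBlock {M : Matrix (Fin 3) (Fin 3) (Grassmann F)}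
    (hM : M ∈ A6LowerBlock F) : ∃ p q r s : Grassmann F, p ∈ Grassmann.part F 0 ∧
      q ∈ Grassmann.part F 1 ∧ M = !![p, q, r; q, p, s; 0, 0, 0] := by
  obtain ⟨h, ⟨h1, h2, h3⟩, h4, h5⟩ := hM
  refine ⟨M 0 0, M 0 1, M 0 2, M 1 2, by simpa using (mem_GUT.1 h).2 0 0,
    by simpa using (mem_GUT.1 h).2 0 1, ?_⟩
  ext i j
  fin_cases i <;> fin_cases j <;> simp [*]

/-- As in $G$, only the odd parts contribute to a commutator of the corners, and their contribution
is even, hence central. -/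
theorem exists_lie_eq_of_mem_lowerBlock {M N : Matrix (Fin 3) (Fin 3) (Grassmann F)}
    (hM : M ∈ A6LowerBlock F) (hN : N ∈ A6LowerBlock F) :
    ∃ z r s : Grassmann F, z ∈ Grassmann.part F 0 ∧
      M * N - N * M = !![z, 0, r; 0, z, s; 0, 0, 0] := by
  obtain ⟨p, q, r, s, hp, hq, rfl⟩ := exists_eq_of_mem_lowerBlock hM
  obtain ⟨p', q', r', s', hp', hq', rfl⟩ := exists_eq_of_mem_lowerBlock hN
  have h1 := mul_comm_of_even hp p'
  have h2 := mul_comm_of_even hp q'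
  have h3 := mul_comm_of_even hp' q
  have h4 {a b : Grassmann F} (ha : a ∈ Grassmann.part F 1) (hb : b ∈ Grassmann.part F 1) :
      a * b ∈ Grassmann.part F 0 := by
    have := SetLike.mul_mem_graded ha hb
    rwa [show (1 + 1 : ZMod 2) = 0 from rfl] at this
  refine ⟨q * q' - q' * q, p * r' + q * s' - (p' * r + q' * s), q * r' + p * s' - (q' * r + p' * s),
    sub_mem (h4 hq hq') (h4 hq' hq), ?_⟩
  ext i j
  fin_cases i <;> fin_cases j <;>
    simp [h1, h2, h3, add_comm (q' * p) (q * p')]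

/-- The corner of the inner commutator is a central scalar matrix, so the triple commutator is
confined to the last column, which the zero last row of the right factor annihilates. -/
theorem lie_lie_mul_mem_identities_lowerBlock (a b c d : FreeAlg F) :
    ⁅⁅a, b⁆, c⁆ * d ∈ identities F (A6LowerBlock F) := by
  intro v
  simp only [Ring.lie_def, map_mul, map_sub]
  generalize evalAt F v a = M
  generalize evalAt F v b = N
  generalize evalAt F v c = P
  generalize evalAt F v d = Q
  apply Subtype.ext
  change ((M.1 * N.1 - N.1 * M.1) * P.1 - P.1 * (M.1 * N.1 - N.1 * M.1)) * Q.1 = 0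
  obtain ⟨z, r, s, hz, h⟩ := exists_lie_eq_of_mem_lowerBlock M.2 N.2
  obtain ⟨p, q, r', s', hp, hq, hP⟩ := exists_eq_of_mem_lowerBlock P.2
  obtain ⟨p', q', r'', s'', hp', hq', hQ⟩ := exists_eq_of_mem_lowerBlock Q.2
  rw [h, hP, hQ]
  have h1 := mul_comm_of_even hz p
  have h2 := mul_comm_of_even hz q
  ext i j
  fin_cases i <;> fin_cases j <;>
    simp [Matrix.mul_apply, Fin.sum_univ_three, h1, h2]

/-! ### The diagonal blocks of `𝒜₆` and the product of their ideals of identities. -/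

theorem A6_apply_eq_zero {M : Matrix (Fin 5) (Fin 5) (Grassmann F)} (hM : M ∈ A6 F) :
    M 2 0 = 0 ∧ M 2 1 = 0 ∧ M 3 0 = 0 ∧ M 3 1 = 0 ∧ M 4 0 = 0 ∧ M 4 1 = 0 := by
  have h := (mem_GUT.1 hM.1).1
  exact ⟨h (by decide), h (by decide), h (by decide), h (by decide), h (by decide), h (by decide)⟩

/-- The upper left block of an element of `𝒜₆`. -/
def A6.upper (F : Type*) [Field F] : A6 F →ₙₐ[F] A6UpperBlock F where
  toFun M := ⟨M.1.submatrix ![0, 1] ![0, 1], by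
    obtain ⟨M, h, ⟨h1, h2, -⟩, -⟩ := M
    refine ⟨mem_GUT.2 ⟨fun i j hij => ?_, fun i j => ?_⟩, by simpa using h1, by simpa using h2⟩
    · fin_cases i <;> fin_cases j <;> simp at hij
    · have := (mem_GUT.1 h).2 (![0, 1] i) (![0, 1] j)
      fin_cases i <;> fin_cases j <;> simpa using this⟩
  map_smul' _ _ := rfl
  map_zero' := rfl
  map_add' _ _ := rfl
  map_mul' := by
    rintro ⟨M, hM⟩ ⟨N, hN⟩
    obtain ⟨h1, h2, h3, h4, h5, h6⟩ := A6_apply_eq_zero hN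
    apply Subtype.ext
    change (M * N).submatrix ![0, 1] ![0, 1] = M.submatrix ![0, 1] ![0, 1] * N.submatrix ![0, 1] ![0, 1]
    ext i j
    simp only [Matrix.submatrix_apply, Matrix.mul_apply, Fin.sum_univ_five, Fin.sum_univ_two]
    fin_cases i <;> fin_cases j <;> simp [h1, h2, h3, h4, h5, h6]

/-- The lower right block of an element of `𝒜₆`. -/
def A6.lower (F : Type*) [Field F] : A6 F →ₙₐ[F] A6LowerBlock F where
  toFun M := ⟨M.1.submatrix ![2, 3, 4] ![2, 3, 4], by
    obtain ⟨M, h, ⟨-, -, h1, h2, h3⟩, h4, h5⟩ := M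
    refine ⟨mem_GUT.2 ⟨fun i j hij => ?_, fun i j => ?_⟩, by simp [*], by simp [*], by simp [*]⟩
    · fin_cases i <;> fin_cases j <;> simp at hij
    · have := (mem_GUT.1 h).2 (![2, 3, 4] i) (![2, 3, 4] j)
      fin_cases i <;> fin_cases j <;> simpa using this⟩
  map_smul' _ _ := rfl
  map_zero' := rfl
  map_add' _ _ := rfl
  map_mul' := by
    rintro ⟨M, hM⟩ ⟨N, hN⟩
    obtain ⟨h1, h2, h3, h4, h5, h6⟩ := A6_apply_eq_zero hM
    apply Subtype.ext
    change (M * N).submatrix ![2, 3, 4] ![2, 3, 4] =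
      M.submatrix ![2, 3, 4] ![2, 3, 4] * N.submatrix ![2, 3, 4] ![2, 3, 4]
    ext i j
    simp only [Matrix.submatrix_apply, Matrix.mul_apply, Fin.sum_univ_five, Fin.sum_univ_three]
    fin_cases i <;> fin_cases j <;> simp [h1, h2, h3, h4, h5, h6]

theorem map_evalAt {A B : Type*} [NonUnitalRing A] [Module F A] [IsScalarTower F A A]
    [SMulCommClass F A A] [NonUnitalRing B] [Module F B] [IsScalarTower F B B]
    [SMulCommClass F B B] (φ : A →ₙₐ[F] B) (a : ℕ → A) (f : FreeAlg F) :
    φ (evalAt F a f) = evalAt F (fun i => φ (a i)) f := by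
  have : φ.comp (evalAt F a) = evalAt F (fun i => φ (a i)) :=
    FreeAlg.hom_ext fun i => by simp [evalAt_x]
  exact DFunLike.congr_fun this f

/-- The value of the first factor has its first two columns zero and the value of the second its
last three rows zero, so every term of the matrix product vanishes. -/
theorem idealProd_le_identities_A6 :
    idealProd (identities F (A6UpperBlock F)) (identities F (A6LowerBlock F)) ≤
      identities F (A6 F) := by
  refine Submodule.span_le.2 ?_
  rintro _ ⟨f, hf, g, hg, rfl⟩ a
  rw [map_mul]
  have hM : A6.upper F (evalAt F a f) = 0 := by rw [map_evalAt]; exact hf _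
  have hN : A6.lower F (evalAt F a g) = 0 := by rw [map_evalAt]; exact hg _
  generalize evalAt F a f = M at hM ⊢
  generalize evalAt F a g = N at hN ⊢
  obtain ⟨h1, h2, h3, h4, h5, h6⟩ := A6_apply_eq_zero M.2
  obtain ⟨k1, k2, k3, k4, k5, k6⟩ := A6_apply_eq_zero N.2
  have hM' (i j : Fin 2) : M.1 (![0, 1] i) (![0, 1] j) = 0 :=
    congrFun (congrFun (congrArg Subtype.val hM) i) j
  have hN' (i j : Fin 3) : N.1 (![2, 3, 4] i) (![2, 3, 4] j) = 0 :=
    congrFun (congrFun (congrArg Subtype.val hN) i) j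
  have m0 (i : Fin 5) : M.1 i 0 = 0 := by
    fin_cases i
    exacts [hM' 0 0, hM' 1 0, h1, h3, h5]
  have m1 (i : Fin 5) : M.1 i 1 = 0 := by
    fin_cases i
    exacts [hM' 0 1, hM' 1 1, h2, h4, h6]
  have n2 (j : Fin 5) : N.1 2 j = 0 := by
    fin_cases j
    exacts [k1, k2, hN' 0 0, hN' 0 1, hN' 0 2]
  have n3 (j : Fin 5) : N.1 3 j = 0 := by
    fin_cases j
    exacts [k3, k4, hN' 1 0, hN' 1 1, hN' 1 2]
  have n4 (j : Fin 5) : N.1 4 j = 0 := by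
    fin_cases j
    exacts [k5, k6, hN' 2 0, hN' 2 1, hN' 2 2]
  apply Subtype.ext
  change M.1 * N.1 = 0
  ext i j
  simp [Matrix.mul_apply, Fin.sum_univ_five, m0, m1, n2, n3, n4]

/-! ### Polynomials that vanish on the blocks -/

/-- This allows a polynomial followed by a variable to be replaced by its normal form modulo triple
commutators when evaluated on the lower block. -/
theorem evalU_lieIdeal_mul_X {q : UFree F} (hq : q ∈ lieIdeal F) (l : ℕ)
    {L : ℕ → Matrix (Fin 3) (Fin 3) (Grassmann F)} (hL : ∀ i, L i ∈ A6LowerBlock F) :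
    evalU L (q * X F l) = 0 := by
  obtain ⟨g, hg, hg'⟩ := (isTIdeal_identities (A6LowerBlock F)).lieIdeal_mul_incl_mem
    lie_lie_mul_mem_identities_lowerBlock hq (x F l)
  have hg' : incl g = q * X F l := hg'
  rw [← hg', evalU_incl]
  exact mem_identities_subalgebra.1 hg L hL

/-- Split off the last letter. The row $(0,0,1)$ detects the constant term; the row $(1,0,0)$, read
in the last column, detects the coefficient of each last letter, which is then handled by its normal
form. -/
theorem exists_eq_sum_lieIdeal_mul_X [CharZero F] (h : UFree F)
    (H : ∀ (t r : ℕ → F) (q : ℕ → Grassmann F), (∀ i, q i ∈ Grassmann.part F 1) →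
      ∀ w w' : F, Matrix.vecMul ![algebraMap F (Grassmann F) w, 0, algebraMap F (Grassmann F) w']
        (evalU (fun i => lowerElt (t i) (r i) (q i)) h) = 0) :
    ∃ g : ℕ →₀ UFree F, h = g.sum (fun l k => k * X F l) ∧ ∀ l, g l ∈ lieIdeal F := by
  obtain ⟨c, g, rfl⟩ := exists_eq_sum_mul_X h
  have hc : c = 0 := by
    -- At the zero matrices every term ending in a variable vanishes.
    have h1 := congrFun (H 0 0 0 (fun _ => zero_mem _) 0 1) 2
    have h2 (i : ℕ) : Matrix.vecMul ![algebraMap F (Grassmann F) 0, 0, algebraMap F (Grassmann F) 1]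
        (evalU (fun i => lowerElt ((0 : ℕ → F) i) ((0 : ℕ → F) i) ((0 : ℕ → Grassmann F) i))
          (g i * X F i)) 2 = 0 := by
      rw [map_mul, evalU_X]
      simp [lowerElt, Matrix.vecMul, dotProduct, Matrix.mul_apply, Fin.sum_univ_three]
    rw [map_add, AlgHom.commutes, Matrix.vecMul_add, map_finsuppSum, Finsupp.sum, Pi.add_apply,
      Matrix.vecMul_sum, Finset.sum_apply, Finset.sum_congr rfl fun i _ => h2 i,
      Finset.sum_const_zero, add_zero] at h1
    simpa [Matrix.vecMul, dotProduct, Fin.sum_univ_three, Matrix.algebraMap_matrix_apply] using h1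
  subst hc
  refine ⟨g, by simp, fun l => ?_⟩
  choose γ hγ using exists_sub_mem_lieIdeal (F := F)
  have key (J : Finset ℕ) (μ : Multiset ℕ) : γ (g l) (μ, J) • cprod (X F) J.toList = 0 := by
    -- With this $r$ the last column of $L_l$ is the first unit vector and that of every other $L_k$
    -- is zero, so the entry in the first row and last column isolates the coefficient of $x_l$.
    refine smul_cprod_eq_zero _ (Pi.single l 1) (fun t q hq => ?_) J μ
    set L : ℕ → Matrix (Fin 3) (Fin 3) (Grassmann F) :=
      fun i => lowerElt (t i) ((Pi.single l 1 : ℕ → F) i) (q i) with hL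
    have hLmem (i : ℕ) : L i ∈ A6LowerBlock F := lowerElt_mem (hq i)
    have h1 := congrFun (H t (Pi.single l 1) q hq 1 0) 2
    rw [map_zero (algebraMap F (UFree F)), zero_add, map_finsuppSum, Finsupp.sum,
      Matrix.vecMul_sum, Finset.sum_apply] at h1
    have h2 (k : ℕ) : Matrix.vecMul ![algebraMap F (Grassmann F) 1, 0, algebraMap F (Grassmann F) 0]
        (evalU L (g k * X F k)) 2 = if k = l then
        (evalU L ((γ (g l)).sum fun p c =>
          c • (word (X F) p.1.toList * cprod (X F) p.2.toList))).mulVec (firstCol 1) 0 else 0 := by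
      have h3 := evalU_lieIdeal_mul_X (hγ (g k)) k hLmem
      rw [sub_mul, map_sub, sub_eq_zero] at h3
      rw [h3, map_mul, evalU_X]
      split_ifs with hk
      · subst hk
        simp [hL, lowerElt, Matrix.vecMul, Matrix.mulVec, firstCol, dotProduct, Matrix.mul_apply,
          Fin.sum_univ_three]
      · simp [hL, lowerElt, Matrix.vecMul, dotProduct, Matrix.mul_apply, Fin.sum_univ_three,
          Pi.single_eq_of_ne hk]
    rw [Finset.sum_congr rfl fun k _ => h2 k, Finset.sum_ite_eq'] at h1
    split_ifs at h1 with hl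
    · exact h1
    -- Here $g_l=0$, but its chosen normal form need not be the zero combination; that its
    -- evaluation vanishes is read off from `h2`.
    · have h4 := h2 l
      rw [Finsupp.notMem_support_iff.1 hl, if_pos rfl, zero_mul, map_zero (evalU L), Matrix.vecMul_zero] at h4
      rw [Finsupp.notMem_support_iff.1 hl]
      exact h4.symm
  have h5 : ((γ (g l)).sum fun p c =>
      c • (word (X F) p.1.toList * cprod (X F) p.2.toList)) = 0 := by
    refine Finset.sum_eq_zero fun p _ => ?_
    change γ (g l) p • (word (X F) p.1.toList * cprod (X F) p.2.toList) = 0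
    rw [← mul_smul_comm, key p.2 p.1, mul_zero]
  simpa [h5] using hγ (g l)

end Blocks

/-! ### The identities of `𝒜₆`. -/

section FirstAlgebra

variable {F : Type*} [Field F]

open SuperPI.UFree (incl)

/-- Elements of `𝒜₆`. -/
def fullElt (α b w w' t r : F) (q : Grassmann F) : Matrix (Fin 5) (Fin 5) (Grassmann F) :=
  !![0, algebraMap F _ α, 0, 0, 0;
    0, algebraMap F _ b, algebraMap F _ w, 0, algebraMap F _ w';
    0, 0, algebraMap F _ t, q, algebraMap F _ r;
    0, 0, q, algebraMap F _ t, 0;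
    0, 0, 0, 0, 0]

theorem fullElt_mem {α b w w' t r : F} {q : Grassmann F} (hq : q ∈ Grassmann.part F 1) :
    fullElt α b w w' t r q ∈ A6 F := by
  refine ⟨mem_GUT.2 ⟨fun i j hij => ?_, fun i j => ?_⟩, ?_⟩
  · fin_cases i <;> fin_cases j <;> first | rfl | simp at hij
  · fin_cases i <;> fin_cases j <;>
      simp [fullElt, algebraMap_mem_part, hq, show (-1 : ZMod 2) = 1 from rfl,
        show (1 + 1 : ZMod 2) = 0 from rfl]
  · simp [fullElt]

variable (F) in
/-- The inclusion of the row vectors of the lower right block. -/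
def rowEmb : (Fin 3 → Grassmann F) →ₗ[F] (Fin 5 → Grassmann F) where
  toFun u := ![0, 0, u 0, u 1, u 2]
  map_add' u v := by ext i; fin_cases i <;> simp
  map_smul' c u := by ext i; fin_cases i <;> simp

theorem vecMul_zero_fullElt (α b w w' t r : F) (q : Grassmann F) :
    Matrix.vecMul (Pi.single 0 1) (fullElt α b w w' t r q) = α • Pi.single 1 1 := by
  ext i; fin_cases i <;> simp [fullElt, Algebra.algebraMap_eq_smul_one]

/-- Together with `vecMul_rowEmb_fullElt` this supplies the two hypotheses of
`exists_swapDiff_decomposition` for the second unit row. -/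
theorem vecMul_one_fullElt (α b w w' t r : F) (q : Grassmann F) :
    Matrix.vecMul (Pi.single 1 1) (fullElt α b w w' t r q) =
      b • (Pi.single 1 1 : Fin 5 → Grassmann F) + rowEmb F ![algebraMap F _ w, 0, algebraMap F _ w'] := by
  ext i; fin_cases i <;> simp [fullElt, rowEmb, Algebra.algebraMap_eq_smul_one]

theorem vecMul_rowEmb_fullElt (α b w w' t r : F) (q : Grassmann F) (u : Fin 3 → Grassmann F) :
    Matrix.vecMul (rowEmb F u) (fullElt α b w w' t r q) =
      rowEmb F (Matrix.vecMul u (lowerElt t r q)) := by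
  ext i
  simp only [Matrix.vecMul, dotProduct, Fin.sum_univ_five, rowEmb, LinearMap.coe_mk, AddHom.coe_mk]
  fin_cases i <;> simp [fullElt, lowerElt, Fin.sum_univ_three]

/-- The first row of $X_k$ is $\delta_{kj}$ times the second unit row, so the first row of $f=\sum
X_kg_k$ is the second row of $g_j$. -/
theorem vecMul_single_one_eq_zero {f : FreeAlg F} (hf : f ∈ identities F (A6 F))
    {g : ℕ →₀ UFree F} (hg : incl f = g.sum fun j h => X F j * h) (j : ℕ) (b w w' t r : ℕ → F)
    (q : ℕ → Grassmann F) (hq : ∀ i, q i ∈ Grassmann.part F 1) :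
    Matrix.vecMul (Pi.single 1 1) (evalU (fun i => fullElt ((Pi.single j 1 : ℕ → F) i) (b i) (w i)
      (w' i) (t i) (r i) (q i)) (g j)) = 0 := by
  set a := fun i => fullElt ((Pi.single j 1 : ℕ → F) i) (b i) (w i) (w' i) (t i) (r i) (q i) with ha
  have h1 : evalU a (incl f) = 0 := by
    rw [evalU_incl]
    exact mem_identities_subalgebra.1 hf a fun i => fullElt_mem (hq i)
  have h2 := congrArg (Matrix.vecMul (Pi.single 0 1)) h1
  have h3 (k : ℕ) : Matrix.vecMul (Pi.single 0 1) (evalU a (X F k * g k)) =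
      if k = j then Matrix.vecMul (Pi.single 1 1) (evalU a (g j)) else 0 := by
    rw [map_mul, evalU_X, ← Matrix.vecMul_vecMul, ha, vecMul_zero_fullElt, ← ha]
    split_ifs with hk
    · subst hk; rw [Pi.single_eq_same, one_smul]
    · rw [Pi.single_eq_of_ne hk, zero_smul, Matrix.zero_vecMul]
  rw [Matrix.vecMul_zero, hg, map_finsuppSum, Finsupp.sum, Matrix.vecMul_sum,
    Finset.sum_congr rfl fun k _ => h3 k, Finset.sum_ite_eq'] at h2
  split_ifs at h2 with hj
  · exact h2
  · rw [Finsupp.notMem_support_iff.1 hj, map_zero, Matrix.vecMul_zero]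

/-- Identities of `𝒜₆` are sums of products of a variable, elements of the ideals generated by
commutators and by commutators of length three, and a variable. -/
theorem mem_of_mem_identities_A6 [CharZero F] {V : Submodule F (FreeAlg F)}
    (hV : ∀ j l, ∀ p ∈ commIdeal F, ∀ q ∈ lieIdeal F, ∀ f : FreeAlg F,
      incl f = X F j * p * (q * X F l) → f ∈ V)
    {f : FreeAlg F} (hf : f ∈ identities F (A6 F)) : f ∈ V := by
  have hmem (j l : ℕ) (p q : UFree F) (hp : p ∈ commIdeal F) (hq : q ∈ lieIdeal F) :
      X F j * p * (q * X F l) ∈ V.map (incl (F := F) : FreeAlg F →ₗ[F] UFree F) := by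
    obtain ⟨s, hs⟩ := exists_incl_eq_incl_mul (x F j) (p * (q * X F l))
    have hs' : incl s = X F j * p * (q * X F l) := by rw [hs, ← mul_assoc]; rfl
    exact ⟨s, hV j l p hp q hq s hs', hs'⟩
  suffices h : incl f ∈ V.map (incl (F := F) : FreeAlg F →ₗ[F] UFree F) by
    obtain ⟨s, hs, hs'⟩ := h
    rwa [← UFree.incl_injective hs']
  obtain ⟨g, hg⟩ := f.exists_eq_sum_X_mul
  rw [hg]
  refine Submodule.sum_mem _ fun j _ => ?_
  obtain ⟨c, d, hcd, H⟩ := exists_swapDiff_decomposition (rowEmb F) (g j)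
  classical
  have key (μ : Multiset ℕ) (i : ℕ) (t r : ℕ → F) (q : ℕ → Grassmann F)
      (hq : ∀ i, q i ∈ Grassmann.part F 1) (w w' : F) :
      c μ • (Pi.single 1 1 : Fin 5 → Grassmann F) + rowEmb F (Matrix.vecMul
        ![algebraMap F (Grassmann F) w, 0, algebraMap F (Grassmann F) w']
        (evalU (fun i => lowerElt (t i) (r i) (q i)) (d (μ, i)))) = 0 := by
    set L := fun i => lowerElt (t i) (r i) (q i) with hL
    set u : Fin 3 → Grassmann F :=
      ![algebraMap F (Grassmann F) w, 0, algebraMap F (Grassmann F) w'] with hu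
    -- A common index set for both sums, enlarged by $\mu$ so that no case distinction on the
    -- supports is needed.
    let s : Finset (Multiset ℕ) := insert μ (c.support ∪ d.support.image Prod.fst)
    refine eq_zero_of_forall_sum_prod_smul_eq_zero (F := F) s (fun ν => c ν • (Pi.single 1 1 : Fin 5 → Grassmann F) +
      rowEmb F (Matrix.vecMul u (evalU L (d (ν, i))))) (fun b => ?_) (Finset.mem_insert_self _ _)
    -- Letting only the variable $i$ have nonzero entries $w,w'$ singles out the coefficients
    -- $d(\nu,i)$, while $b$ stays free to separate the monomials $\nu$.
    have h1 := vecMul_single_one_eq_zero hf hg j b (Pi.single i w) (Pi.single i w') t r q hq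
    have hu' (k : ℕ) : ![algebraMap F (Grassmann F) ((Pi.single i w : ℕ → F) k), 0,
        algebraMap F (Grassmann F) ((Pi.single i w' : ℕ → F) k)] = if k = i then u else 0 := by
      split_ifs with hk
      · subst hk; rw [Pi.single_eq_same, Pi.single_eq_same]
      · rw [Pi.single_eq_of_ne hk, Pi.single_eq_of_ne hk, map_zero]
        ext i; fin_cases i <;> rfl
    rw [H _ L (Pi.single 1 1) b (fun k => if k = i then u else 0)
      (fun k => by rw [vecMul_one_fullElt, hu'])
      (fun k v => vecMul_rowEmb_fullElt _ _ _ _ _ _ _ v),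
      Finsupp.sum_of_support_subset (s := s) c (fun ν hν => Finset.mem_insert_of_mem
        (Finset.mem_union_left _ hν)) _ (by simp),
      Finsupp.sum_of_support_subset (s := s ×ˢ insert i (d.support.image Prod.snd)) d
        (fun p hp => Finset.mem_product.2 ⟨Finset.mem_insert_of_mem (Finset.mem_union_right _
          (Finset.mem_image_of_mem _ hp)), Finset.mem_insert_of_mem
          (Finset.mem_image_of_mem _ hp)⟩) _ (by simp), Finset.sum_product] at h1
    rw [← h1, ← Finset.sum_add_distrib]
    refine Finset.sum_congr rfl fun ν _ => ?_
    rw [smul_add, Finset.sum_eq_single_of_mem i (Finset.mem_insert_self _ _)]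
    · simp
    · intro k _ hk
      simp [hk]
  have hc (μ : Multiset ℕ) : c μ = 0 := by
    have h1 := congrFun (key μ 0 0 0 0 (fun _ => zero_mem _) 0 0) 1
    have h2 : c μ • (1 : Grassmann F) = 0 := by simpa [rowEmb] using h1
    simpa using h2
  change X F j * g j ∈ _
  rw [hcd, Finsupp.sum, Finset.sum_eq_zero fun μ _ => by rw [hc, zero_smul], zero_add, Finsupp.mul_sum]
  refine Submodule.sum_mem _ fun p _ => ?_
  obtain ⟨k, hk, hk'⟩ := exists_eq_sum_lieIdeal_mul_X (d p) fun t r q hq w w' => by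
    have h1 := key p.1 p.2 t r q hq w w'
    rw [hc, zero_smul, zero_add] at h1
    ext i
    fin_cases i
    exacts [congrFun h1 2, congrFun h1 3, congrFun h1 4]
  change X F j * (swapDiff F p * d p) ∈ _
  rw [hk, Finsupp.mul_sum, Finsupp.mul_sum]
  refine Submodule.sum_mem _ fun l _ => ?_
  change X F j * (swapDiff F p * (k l * X F l)) ∈ _
  rw [← mul_assoc]
  exact hmem _ _ _ _ (swapDiff_mem_commIdeal p) (hk' l)

theorem identities_A6_eq_idealProd [CharZero F] : identities F (A6 F) =
    idealProd (identities F (A6UpperBlock F)) (identities F (A6LowerBlock F)) := by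
  refine le_antisymm (fun f hf => mem_of_mem_identities_A6 ?_ hf) idealProd_le_identities_A6
  intro j l p hp q hq f hf
  obtain ⟨r, hr, hr'⟩ := (isTIdeal_identities (A6UpperBlock F)).incl_mul_commIdeal_mem
    mul_lie_mem_identities_upperBlock (x F j) hp
  obtain ⟨s, hs, hs'⟩ := (isTIdeal_identities (A6LowerBlock F)).lieIdeal_mul_incl_mem
    lie_lie_mul_mem_identities_lowerBlock hq (x F l)
  have : f = r * s := UFree.incl_injective (by
    rw [hf, map_mul]
    exact (congrArg₂ (· * ·) hr' hs').symm)
  rw [this]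
  exact Submodule.subset_span ⟨r, hr, s, hs, rfl⟩

/-- The values of `x₁[x₂,x₃][x₄,x₅,x₆]x₇` lie in the `T`-ideal that it generates. -/
theorem value_mem_tIdeal (y a b c d e z : FreeAlg F) : y * ⁅a, b⁆ * ⁅⁅c, d⁆, e⁆ * z ∈
    tIdeal {x F 1 * ⁅x F 2, x F 3⁆ * ⁅⁅x F 4, x F 5⁆, x F 6⁆ * x F 7} := by
  have h1 := (isTIdeal_tIdeal {x F 1 * ⁅x F 2, x F 3⁆ * ⁅⁅x F 4, x F 5⁆, x F 6⁆ * x F 7}).map_endo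
    (evalAt F fun i => if i = 1 then y else if i = 2 then a else if i = 3 then b else
      if i = 4 then c else if i = 5 then d else if i = 6 then e else z) _
    (subset_tIdeal (F := F) _ (Set.mem_singleton _))
  convert h1 using 1
  simp [Ring.lie_def, evalAt_x]

theorem identities_A6_eq_tIdeal [CharZero F] : identities F (A6 F) =
    tIdeal {x F 1 * ⁅x F 2, x F 3⁆ * ⁅⁅x F 4, x F 5⁆, x F 6⁆ * x F 7} := by
  refine le_antisymm (fun f hf => mem_of_mem_identities_A6 ?_ hf)
    (tIdeal_le (isTIdeal_identities _) ?_)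
  · intro j l p hp q hq f hf
    obtain ⟨s, hs, hs'⟩ := incl_mul_commIdeal_mul_lieIdeal_mem value_mem_tIdeal hp hq (x F j) (x F l)
    have : f = s := UFree.incl_injective (hf.trans hs'.symm)
    rwa [this]
  · rw [Set.singleton_subset_iff, SetLike.mem_coe, mul_assoc]
    exact idealProd_le_identities_A6 (Submodule.subset_span
      ⟨_, mul_lie_mem_identities_upperBlock _ _ _, _, lie_lie_mul_mem_identities_lowerBlock _ _ _ _,
        rfl⟩)

end FirstAlgebra

/-! ### Passage to `𝒜₇` by anti-isomorphism. -/

section Reversal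

variable {F : Type*} [Field F]

variable (F) in
/-- The reversal of the words. -/
def rev : FreeAlg F →ₗ[F] FreeAlg F :=
  (MulOpposite.opLinearEquiv F).symm.toLinearMap ∘ₗ
    (evalAt F fun i => MulOpposite.op (x F i) : FreeAlg F →ₗ[F] (FreeAlg F)ᵐᵒᵖ)

theorem rev_x (i : ℕ) : rev F (x F i) = x F i := by
  change MulOpposite.unop (evalAt F _ (x F i)) = _
  rw [evalAt_x]
  rfl

theorem rev_mul (f g : FreeAlg F) : rev F (f * g) = rev F g * rev F f := by
  change MulOpposite.unop (evalAt F _ (f * g)) = _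
  rw [map_mul]
  rfl

/-- Both sides are homomorphisms from the free algebra to the opposite of $B$ that agree on the
variables. -/
theorem map_evalAt_rev {A B : Type*} [NonUnitalRing A] [Module F A] [IsScalarTower F A A]
    [SMulCommClass F A A] [NonUnitalRing B] [Module F B] [IsScalarTower F B B]
    [SMulCommClass F B B] (θ : A →ₗ[F] B) (hθ : ∀ a b, θ (a * b) = θ b * θ a) (a : ℕ → A)
    (f : FreeAlg F) : θ (evalAt F a f) = evalAt F (fun i => θ (a i)) (rev F f) := by
  let ψ : FreeAlg F →ₙₐ[F] Bᵐᵒᵖ :=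
    { toFun := fun f => MulOpposite.op (θ (evalAt F a f))
      map_smul' := fun c f => by simp
      map_zero' := by simp
      map_add' := fun f g => by simp
      map_mul' := fun f g => by simp [hθ] }
  let χ : FreeAlg F →ₙₐ[F] Bᵐᵒᵖ :=
    { toFun := fun f => MulOpposite.op (evalAt F (fun i => θ (a i)) (rev F f))
      map_smul' := fun c f => by simp
      map_zero' := by simp
      map_add' := fun f g => by simp
      map_mul' := fun f g => by simp [rev_mul] }
  have : ψ = χ := FreeAlg.hom_ext fun i => by
    change MulOpposite.op (θ (evalAt F a (x F i))) =
      MulOpposite.op (evalAt F (fun i => θ (a i)) (rev F (x F i)))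
    rw [rev_x, evalAt_x, evalAt_x]
  exact congrArg MulOpposite.unop (DFunLike.congr_fun this f)

theorem evalAt_comp_x (φ : FreeAlg F →ₙₐ[F] FreeAlg F) : evalAt F (fun i => φ (x F i)) = φ :=
  FreeAlg.hom_ext fun i => by simp [evalAt_x]

theorem rev_rev (f : FreeAlg F) : rev F (rev F f) = f := by
  let φ : FreeAlg F →ₙₐ[F] FreeAlg F :=
    { toFun := fun f => rev F (rev F f)
      map_smul' := fun c f => by simp
      map_zero' := by simp
      map_add' := fun f g => by simp
      map_mul' := fun f g => by simp [rev_mul] }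
  have : φ = NonUnitalAlgHom.id F (FreeAlg F) := FreeAlg.hom_ext fun i => by
    change rev F (rev F (x F i)) = x F i
    rw [rev_x, rev_x]
  exact DFunLike.congr_fun this f

theorem IsTIdeal.comap_rev {I : Submodule F (FreeAlg F)} (hI : IsTIdeal I) :
    IsTIdeal (I.comap (rev F)) where
  mul_left g f hf := by
    rw [Submodule.mem_comap, rev_mul]
    exact hI.mul_right _ _ hf
  mul_right g f hf := by
    rw [Submodule.mem_comap, rev_mul]
    exact hI.mul_left _ _ hf
  map_endo φ f hf := by
    rw [Submodule.mem_comap, ← evalAt_comp_x φ, map_evalAt_rev (rev F) rev_mul]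
    exact hI.map_endo _ _ hf

theorem rev_mem_idealProd {I J I' J' : Submodule F (FreeAlg F)} (hI : ∀ f ∈ I, rev F f ∈ I')
    (hJ : ∀ f ∈ J, rev F f ∈ J') {f : FreeAlg F} (hf : f ∈ idealProd I J) :
    rev F f ∈ idealProd J' I' := by
  have : idealProd I J ≤ (idealProd J' I').comap (rev F) := by
    refine Submodule.span_le.2 ?_
    rintro _ ⟨f, hf, g, hg, rfl⟩
    rw [SetLike.mem_coe, Submodule.mem_comap, rev_mul]
    exact Submodule.subset_span ⟨_, hJ g hg, _, hI f hf, rfl⟩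
  exact this hf

/-! ### Transposition -/

/-- Reversal of the entries, transposition, and permutation of the indices. -/
def transposeRev {n : ℕ} (σ : Equiv.Perm (Fin n)) :
    Matrix (Fin n) (Fin n) (Grassmann F) →ₗ[F] Matrix (Fin n) (Fin n) (Grassmann F) where
  toFun M := Matrix.of fun i j => CliffordAlgebra.reverse (M (σ j) (σ i))
  map_add' M N := by ext i j; simp
  map_smul' c M := by ext i j; simp

theorem transposeRev_apply {n : ℕ} (σ : Equiv.Perm (Fin n))
    (M : Matrix (Fin n) (Fin n) (Grassmann F)) (i j : Fin n) :
    transposeRev σ M i j = CliffordAlgebra.reverse (M (σ j) (σ i)) := rfl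

theorem transposeRev_mul {n : ℕ} (σ : Equiv.Perm (Fin n))
    (M N : Matrix (Fin n) (Fin n) (Grassmann F)) :
    transposeRev σ (M * N) = transposeRev σ N * transposeRev σ M := by
  ext i j
  simp only [transposeRev_apply, Matrix.mul_apply, map_sum]
  rw [← Equiv.sum_comp σ]
  exact Finset.sum_congr rfl fun k _ => CliffordAlgebra.reverse.map_mul _ _

theorem transposeRev_symm {n : ℕ} (σ : Equiv.Perm (Fin n))
    (M : Matrix (Fin n) (Fin n) (Grassmann F)) :
    transposeRev σ (transposeRev σ.symm M) = M := by
  ext i j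
  rw [transposeRev_apply, transposeRev_apply, CliffordAlgebra.reverse_reverse,
    Equiv.symm_apply_apply, Equiv.symm_apply_apply]

theorem transposeRev_mem_GUT {n : ℕ} (σ : Equiv.Perm (Fin n)) {b b' : Fin n → ℕ}
    {h h' : Fin n → ZMod 2} (hb : ∀ i j, b' j < b' i → b (σ i) < b (σ j))
    (hh : ∀ i j, -h (σ j) + h (σ i) = -h' i + h' j)
    {M : Matrix (Fin n) (Fin n) (Grassmann F)} (hM : M ∈ GUT F b h) :
    transposeRev σ M ∈ GUT F b' h' := by
  rw [mem_GUT] at *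
  refine ⟨fun i j hij => ?_, fun i j => ?_⟩
  · rw [transposeRev_apply, hM.1 (hb i j hij), map_zero]
  · rw [transposeRev_apply, ← hh]
    exact (CliffordAlgebra.reverse_mem_evenOdd_iff _).2 (hM.2 _ _)

/-- Transposition with reversed entries is an antihomomorphism, also over the noncommutative $G$;
the two given maps are mutually inverse between $S$ and $T$, and anti-isomorphic algebras have
reversed identities. -/
theorem mem_identities_iff_rev {n : ℕ} (σ : Equiv.Perm (Fin n))
    {S T : NonUnitalSubalgebra F (Matrix (Fin n) (Fin n) (Grassmann F))}
    (hS : ∀ M ∈ S, transposeRev σ M ∈ T) (hT : ∀ M ∈ T, transposeRev σ.symm M ∈ S)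
    {f : FreeAlg F} : f ∈ identities F S ↔ rev F f ∈ identities F T := by
  rw [mem_identities_subalgebra, mem_identities_subalgebra]
  refine ⟨fun h b hb => ?_, fun h a ha => ?_⟩
  · have h1 := map_evalAt_rev (transposeRev σ) (transposeRev_mul σ)
      (fun i => transposeRev σ.symm (b i)) f
    rw [h _ fun i => hT _ (hb i), map_zero] at h1
    simp only [transposeRev_symm] at h1
    exact h1.symm
  · have h1 := map_evalAt_rev (transposeRev σ) (transposeRev_mul σ) a f
    rw [h _ fun i => hS _ (ha i)] at h1
    have h2 := transposeRev_symm σ.symm (evalAt F a f)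
    rw [Equiv.symm_symm, h1, map_zero] at h2
    exact h2.symm

/-- The order of the indices that turns `𝒜₇` into the opposite of `𝒜₆`. -/
def permFull : Equiv.Perm (Fin 5) := ⟨![4, 3, 1, 2, 0], ![4, 2, 3, 1, 0], by decide, by decide⟩

/-- The order of the indices that turns the upper block of `𝒜₇` into the opposite of the lower
block of `𝒜₆`. -/
def permThree : Equiv.Perm (Fin 3) := ⟨![1, 2, 0], ![2, 0, 1], by decide, by decide⟩

/-- The order of the indices that turns the lower block of `𝒜₇` into the opposite of the upper
block of `𝒜₆`. -/
def permTwo : Equiv.Perm (Fin 2) := ⟨![1, 0], ![1, 0], by decide, by decide⟩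

/-- Plain reversal of the indices would place the odd index of `𝒜₇` at the wrong position in the
corner $\begin{pmatrix}p&q\\q&p\end{pmatrix}$; `permFull` therefore also exchanges the two indices
of this corner, which its symmetry permits. -/
theorem mem_identities_A7_iff {f : FreeAlg F} :
    f ∈ identities F (A7 F) ↔ rev F f ∈ identities F (A6 F) := by
  refine mem_identities_iff_rev permFull ?_ ?_
  · rintro M ⟨h, ⟨h1, h2, h3, h4, h5⟩, h6, h7⟩
    refine ⟨transposeRev_mem_GUT _ (by decide) (by decide) h, ?_⟩
    simp [transposeRev_apply, permFull, *]
  · rintro M ⟨h, ⟨h1, h2, h3, h4, h5⟩, h6, h7⟩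
    refine ⟨transposeRev_mem_GUT _ (by decide) (by decide) h, ?_⟩
    simp [transposeRev_apply, permFull, *]

theorem mem_identities_A7UpperBlock_iff {f : FreeAlg F} :
    f ∈ identities F (A7UpperBlock F) ↔ rev F f ∈ identities F (A6LowerBlock F) := by
  refine mem_identities_iff_rev permThree ?_ ?_
  · rintro M ⟨h, ⟨h1, h2, h3⟩, h4, h5⟩
    refine ⟨transposeRev_mem_GUT _ (by decide) (by decide) h, ?_⟩
    simp [transposeRev_apply, permThree, *]
  · rintro M ⟨h, ⟨h1, h2, h3⟩, h4, h5⟩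
    refine ⟨transposeRev_mem_GUT _ (by decide) (by decide) h, ?_⟩
    simp [transposeRev_apply, permThree, *]

theorem mem_identities_A7LowerBlock_iff {f : FreeAlg F} :
    f ∈ identities F (A7LowerBlock F) ↔ rev F f ∈ identities F (A6UpperBlock F) := by
  refine mem_identities_iff_rev permTwo ?_ ?_
  · rintro M ⟨h, h1, h2⟩
    refine ⟨transposeRev_mem_GUT _ (by decide) (by decide) h, ?_⟩
    simp [transposeRev_apply, permTwo, *]
  · rintro M ⟨h, h1, h2⟩
    refine ⟨transposeRev_mem_GUT _ (by decide) (by decide) h, ?_⟩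
    simp [transposeRev_apply, permTwo, *]

theorem identities_A7_eq_idealProd [CharZero F] : identities F (A7 F) =
    idealProd (identities F (A7UpperBlock F)) (identities F (A7LowerBlock F)) := by
  ext f
  rw [mem_identities_A7_iff, identities_A6_eq_idealProd]
  refine ⟨fun h => ?_, fun h => ?_⟩
  · rw [← rev_rev f]
    exact rev_mem_idealProd
      (fun g hg => mem_identities_A7LowerBlock_iff.2 (by rwa [rev_rev]))
      (fun g hg => mem_identities_A7UpperBlock_iff.2 (by rwa [rev_rev])) h
  · exact rev_mem_idealProd (fun g hg => mem_identities_A7UpperBlock_iff.1 hg)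
      (fun g hg => mem_identities_A7LowerBlock_iff.1 hg) h

/-- The values of `x₁[x₂,x₃,x₄][x₅,x₆]x₇` lie in the `T`-ideal that it generates. -/
theorem value_mem_tIdeal' (y a b c d e z : FreeAlg F) : y * ⁅⁅a, b⁆, c⁆ * ⁅d, e⁆ * z ∈
    tIdeal {x F 1 * ⁅⁅x F 2, x F 3⁆, x F 4⁆ * ⁅x F 5, x F 6⁆ * x F 7} := by
  have h1 := (isTIdeal_tIdeal {x F 1 * ⁅⁅x F 2, x F 3⁆, x F 4⁆ * ⁅x F 5, x F 6⁆ * x F 7}).map_endo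
    (evalAt F fun i => if i = 1 then y else if i = 2 then a else if i = 3 then b else
      if i = 4 then c else if i = 5 then d else if i = 6 then e else z) _
    (subset_tIdeal (F := F) _ (Set.mem_singleton _))
  convert h1 using 1
  simp [Ring.lie_def, evalAt_x]

theorem identities_A7_eq_tIdeal [CharZero F] : identities F (A7 F) =
    tIdeal {x F 1 * ⁅⁅x F 2, x F 3⁆, x F 4⁆ * ⁅x F 5, x F 6⁆ * x F 7} := by
  ext f
  rw [mem_identities_A7_iff, identities_A6_eq_tIdeal]
  refine ⟨fun h => ?_, fun h => ?_⟩
  · rw [← rev_rev f]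
    refine tIdeal_le (isTIdeal_tIdeal _).comap_rev ?_ h
    rw [Set.singleton_subset_iff, SetLike.mem_coe, Submodule.mem_comap]
    -- Reversal fixes $[x_4,x_5,x_6]$ and changes the sign of $[x_2,x_3]$, so the reversed generator
    -- is a value of the other generator, with $x_2$ and $x_3$ exchanged.
    convert value_mem_tIdeal' (x F 7) (x F 4) (x F 5) (x F 6) (x F 3) (x F 2) (x F 1) using 1
    simp only [Ring.lie_def, rev_mul, map_sub, rev_x]
    noncomm_ring
  · refine tIdeal_le (isTIdeal_tIdeal _).comap_rev ?_ h
    rw [Set.singleton_subset_iff, SetLike.mem_coe, Submodule.mem_comap]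
    convert value_mem_tIdeal (x F 7) (x F 6) (x F 5) (x F 2) (x F 3) (x F 4) (x F 1) using 1
    simp only [Ring.lie_def, rev_mul, map_sub, rev_x]
    noncomm_ring

end Reversal

end SuperPI

end

theorem mainTheorem5 (F : Type*) [Field F] [CharZero F] [IsAlgClosed F] :
    (identities F (A6 F) =
        tIdeal {x F 1 * ⁅x F 2, x F 3⁆ * ⁅⁅x F 4, x F 5⁆, x F 6⁆ * x F 7} ∧
      identities F (A6 F) =
        idealProd (identities F (A6UpperBlock F)) (identities F (A6LowerBlock F))) ∧
    (identities F (A7 F) =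
        tIdeal {x F 1 * ⁅⁅x F 2, x F 3⁆, x F 4⁆ * ⁅x F 5, x F 6⁆ * x F 7} ∧
      identities F (A7 F) =
        idealProd (identities F (A7UpperBlock F)) (identities F (A7LowerBlock F))) :=
  ⟨⟨identities_A6_eq_tIdeal, identities_A6_eq_idealProd⟩,
    ⟨identities_A7_eq_tIdeal, identities_A7_eq_idealProd⟩⟩
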